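/- Let $-\infty<a<b<\infty$, $n\in\mathbb{N}\cup\{0\}$, $m,r,l\in\mathbb{N}$ ($m,r,l\ge 1$) and $1\le p\le\infty$. Let $W^0_p:=L_p([a,b];\mathbb{C})$ and, for $s\ge 1$, let $$W^s_p:=\{y\in C^{s-1}([a,b];\mathbb{C}) : y^{(s-1)}\in AC[a,b],\ y^{(s)}\in L_p[a,b]\},$$ with norm $\|y\|_{s,p}=\sum_{k=0}^{s}\|y^{(k)}\|_p$ for every $s\ge 0$; the spaces $(W^s_p)^m$ and $(W^s_p)^{m\times m}$ of vector- and matrix-valued functions carry the sum of the norms of the entries. Let $A_0,\dots,A_{r-1}\in (W^n_p)^{m\times m}$, put $$Ly:=y^{(r)}+\sum_{j=1}^{r}A_{r-j}\,y^{(r-j)},\qquad L\colon (W^{n+r}_p)^m\to (W^n_p)^m,$$ and let $B\colon (W^{n+r}_p)^m\to\mathbb{C}^l$ be a continuous linear operator. For each $k\in\mathbb{N}$ let $L(k)$ be the operator of the same form with coefficients $A_{r-j}(\cdot,k)\in (W^n_p)^{m\times m}$, and let $B(k)\colon (W^{n+r}_p)^m\to\mathbb{C}^l$ be a continuous linear operator.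 For $i\in\{1,\dots,r\}$ let $Y_i\in (W^{n+r}_p)^{m\times m}$ be the solution of the matrix Cauchy problem $$Y_i^{(r)}+\sum_{j=1}^{r}A_{r-j}Y_i^{(r-j)}=0\ \text{ on }(a,b),\qquad Y_i^{(j-1)}(a)=\delta_{i,j}I_m,\quad j\in\{1,\dots,r\},$$ (the equation being understood almost everywhere if $n=0$), let $[BY_i]\in\mathbb{C}^{l\times m}$ be the matrix whose columns are the images under $B$ of the columns of $Y_i$, and let $$M(L,B):=([BY_1],\dots,[BY_r])\in\mathbb{C}^{l\times rm}$$ be the characteristic matrix. Define $Y_i(\cdot,k)$ and $M(L(k),B(k))$ in the same way from $L(k)$ and $B(k)$. Suppose that $(L(k),B(k))$ converges strongly to $(L,B)$ as $k\to\infty$, that is, $(L(k)y,B(k)y)\to(Ly,By)$ in $(W^n_p)^m\times\mathbb{C}^l$ for every $y\in(W^{n+r}_p)^m$. Then the characteristic matrices are well defined, i.e. the above Cauchy problems for $Y_i$ and for $Y_i(\cdot,k)$ have exactly one solution in $(W^{n+r}_p)^{m\times m}$ for all $i\in\{1,\dots,r\}$ and $k\in\mathbb{N}$, and $$M(L(k),B(k))\to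 M(L,B)\quad\text{as }k\to\infty .$$ -/

import Mathlib

open Set Filter Topology MeasureTheory
open scoped ENNReal

namespace BVP

/-- Membership of a function in the Sobolev space `W^s_p([a,b]; ℂ)`: for `s = 0` it is `L_p`;
for `s ≥ 1` it means `f ∈ C^{s-1}[a,b]`, `f^{(s-1)} ∈ AC[a,b]` and `f^{(s)} ∈ L_p[a,b]`.
Derivatives are taken within `[a,b]`, so they are one-sided at the end points. -/
def MemW (a b : ℝ) (p : ℝ≥0∞) : ℕ → (ℝ → ℂ) → Prop
  | 0, f => MemLp f p (volume.restrict (Icc a b))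
  | s + 1, f => ContDiffOn ℝ (s : ℕ∞) f (Icc a b) ∧
      AbsolutelyContinuousOnInterval (iteratedDerivWithin s f (Icc a b)) a b ∧
      MemLp (iteratedDerivWithin (s + 1) f (Icc a b)) p (volume.restrict (Icc a b))

section Lemmas

variable {a b : ℝ} {p : ℝ≥0∞} {f g : ℝ → ℂ}

theorem ac_congr (hf : AbsolutelyContinuousOnInterval f a b) (h : EqOn f g (uIcc a b)) :
    AbsolutelyContinuousOnInterval g a b := by
  rw [absolutelyContinuousOnInterval_iff] at hf ⊢
  intro ε hε
  obtain ⟨δ, hδ, H⟩ := hf ε hε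
  refine ⟨δ, hδ, fun E hE hE' => ?_⟩
  convert H E hE hE' using 1
  refine Finset.sum_congr rfl fun i hi => ?_
  rw [h (hE.1 i hi).1, h (hE.1 i hi).2]

theorem ac_ae_diff (hab : a < b) (hf : AbsolutelyContinuousOnInterval f a b) :
    ∀ᵐ t ∂(volume.restrict (Icc a b)), DifferentiableWithinAt ℝ f (Icc a b) t := by
  have h := hf.boundedVariationOn
  rw [uIcc_of_le hab.le] at h
  exact h.locallyBoundedVariationOn.ae_differentiableWithinAt measurableSet_Icc

theorem ae_of_eqOn (h : EqOn f g (Icc a b)) : f =ᵐ[volume.restrict (Icc a b)] g := by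
  filter_upwards [ae_restrict_mem measurableSet_Icc] with t ht using h ht

theorem derivWithin_eqOn (h : EqOn f g (Icc a b)) :
    EqOn (derivWithin f (Icc a b)) (derivWithin g (Icc a b)) (Icc a b) :=
  fun _ ht => derivWithin_congr h (h ht)

theorem memW_one : MemW a b p 1 f ↔ ContinuousOn f (Icc a b) ∧
    AbsolutelyContinuousOnInterval f a b ∧
      MemLp (derivWithin f (Icc a b)) p (volume.restrict (Icc a b)) := by
  simp [MemW, iteratedDerivWithin_one]

theorem memW_succ_succ (hab : a < b) {s : ℕ} : MemW a b p (s + 2) f ↔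
    DifferentiableOn ℝ f (Icc a b) ∧ MemW a b p (s + 1) (derivWithin f (Icc a b)) := by
  have h := contDiffOn_succ_iff_derivWithin (n := ((s : ℕ∞) : WithTop ℕ∞)) (f := f)
    (uniqueDiffOn_Icc hab)
  have e : (((s + 1 : ℕ) : ℕ∞) : WithTop ℕ∞) = ((s : ℕ∞) : WithTop ℕ∞) + 1 := by
    push_cast; rfl
  simp only [MemW, iteratedDerivWithin_succ' (n := s + 1), iteratedDerivWithin_succ' (n := s)]
  rw [e, h]
  constructor
  · rintro ⟨⟨h1, -, h2⟩, h3, h4⟩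
    exact ⟨h1, h2, h3, h4⟩
  · rintro ⟨h1, h2, h3, h4⟩
    exact ⟨⟨h1, fun h => by simp at h, h2⟩, h3, h4⟩

theorem MemW.continuousOn {s : ℕ} (h : MemW a b p (s + 1) f) : ContinuousOn f (Icc a b) :=
  h.1.continuousOn

theorem memLp_top_of_continuousOn (h : ContinuousOn f (Icc a b)) :
    MemLp f ∞ (volume.restrict (Icc a b)) := by
  obtain ⟨C, hC⟩ := isCompact_Icc.exists_bound_of_continuousOn h
  refine memLp_top_of_bound (h.aestronglyMeasurable measurableSet_Icc) C ?_
  filter_upwards [ae_restrict_mem measurableSet_Icc] with t ht using hC t ht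

theorem MemW.congr (hab : a < b) {s : ℕ} (hf : MemW a b p s f) (h : EqOn f g (Icc a b)) :
    MemW a b p s g := by
  cases s with
  | zero => exact MemLp.ae_eq (ae_of_eqOn h) hf
  | succ s =>
    refine ⟨hf.1.congr fun t ht => (h ht).symm, ac_congr hf.2.1 ?_,
      hf.2.2.ae_eq (ae_of_eqOn (iteratedDerivWithin_congr h))⟩
    rw [uIcc_of_le hab.le]
    exact iteratedDerivWithin_congr h

theorem MemW.derivWithin (hab : a < b) {s : ℕ} (hf : MemW a b p (s + 1) f) :
    MemW a b p s (derivWithin f (Icc a b)) := by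
  cases s with
  | zero => exact (memW_one.1 hf).2.2
  | succ s => exact ((memW_succ_succ hab).1 hf).2

theorem MemW.of_succ (hab : a < b) {s : ℕ} : ∀ {f : ℝ → ℂ}, MemW a b p (s + 1) f →
    MemW a b p s f := by
  induction s with
  | zero => exact fun hf => (memLp_top_of_continuousOn hf.continuousOn).mono_exponent le_top
  | succ s ih =>
    intro f hf
    have h := ih (hf.derivWithin hab)
    cases s with
    | zero =>
      refine memW_one.2 ⟨hf.continuousOn, ?_, h⟩
      apply ContDiffOn.absolutelyContinuousOnInterval
      rw [uIcc_of_le hab.le]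
      simpa using hf.1
    | succ s => exact (memW_succ_succ hab).2 ⟨((memW_succ_succ hab).1 hf).1, h⟩

theorem MemW.of_le (hab : a < b) {s t : ℕ} (hst : t ≤ s) (hf : MemW a b p s f) :
    MemW a b p t f := by
  induction s, hst using Nat.le_induction with
  | base => exact hf
  | succ s _ ih => exact ih (hf.of_succ hab)

theorem MemW.iteratedDerivWithin (hab : a < b) {s : ℕ} (j : ℕ) : ∀ {f : ℝ → ℂ},
    MemW a b p (s + j) f → MemW a b p s (iteratedDerivWithin j f (Icc a b)) := by
  induction j with
  | zero => intro f hf; simpa using hf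
  | succ j ih =>
    intro f hf
    rw [iteratedDerivWithin_succ']
    exact ih (MemW.derivWithin hab hf)

theorem MemW.memLp (hab : a < b) {s i : ℕ} (hf : MemW a b p s f) (hi : i ≤ s) :
    MemLp (_root_.iteratedDerivWithin i f (Icc a b)) p (volume.restrict (Icc a b)) :=
  MemW.iteratedDerivWithin (s := 0) hab i (hf.of_le hab (by omega))

theorem ae_diff (hab : a < b) {s : ℕ} (hf : MemW a b p (s + 1) f) :
    ∀ᵐ t ∂(volume.restrict (Icc a b)), DifferentiableWithinAt ℝ f (Icc a b) t :=
  ac_ae_diff hab (memW_one.1 (hf.of_le hab (by omega))).2.1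

theorem derivWithin_add_ae (hab : a < b) {s : ℕ} (hf : MemW a b p (s + 1) f)
    (hg : MemW a b p (s + 1) g) : derivWithin (f + g) (Icc a b)
      =ᵐ[volume.restrict (Icc a b)] derivWithin f (Icc a b) + derivWithin g (Icc a b) := by
  filter_upwards [ae_diff hab hf, ae_diff hab hg] with t h1 h2
  exact derivWithin_add h1 h2

theorem derivWithin_add_eqOn (hab : a < b) {s : ℕ} (hf : MemW a b p (s + 2) f)
    (hg : MemW a b p (s + 2) g) : EqOn (derivWithin (f + g) (Icc a b))
      (derivWithin f (Icc a b) + derivWithin g (Icc a b)) (Icc a b) :=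
  fun t ht => derivWithin_add (((memW_succ_succ hab).1 hf).1 t ht)
    (((memW_succ_succ hab).1 hg).1 t ht)

theorem MemW.add (hab : a < b) {s : ℕ} : ∀ {f g : ℝ → ℂ}, MemW a b p s f → MemW a b p s g →
    MemW a b p s (f + g) := by
  induction s with
  | zero => exact fun hf hg => MemLp.add hf hg
  | succ s ih =>
    intro f g hf hg
    cases s with
    | zero =>
      refine memW_one.2 ⟨hf.continuousOn.add hg.continuousOn,
        (memW_one.1 hf).2.1.add (memW_one.1 hg).2.1, ?_⟩
      exact MemLp.ae_eq (derivWithin_add_ae hab hf hg).symm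
        ((memW_one.1 hf).2.2.add (memW_one.1 hg).2.2)
    | succ s =>
      refine (memW_succ_succ hab).2 ⟨((memW_succ_succ hab).1 hf).1.add
        ((memW_succ_succ hab).1 hg).1, ?_⟩
      exact (ih (hf.derivWithin hab) (hg.derivWithin hab)).congr hab
        (derivWithin_add_eqOn hab hf hg).symm

theorem iteratedDerivWithin_add_ae (hab : a < b) {i : ℕ} : ∀ {s : ℕ} {f g : ℝ → ℂ}, i ≤ s →
    MemW a b p s f → MemW a b p s g → iteratedDerivWithin i (f + g) (Icc a b)
      =ᵐ[volume.restrict (Icc a b)]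
        iteratedDerivWithin i f (Icc a b) + iteratedDerivWithin i g (Icc a b) := by
  induction i with
  | zero => intro s f g _ _ _; simp
  | succ i ih =>
    intro s f g hi hf hg
    obtain ⟨s, rfl⟩ : ∃ s', s = s' + 1 := ⟨s - 1, by omega⟩
    simp only [iteratedDerivWithin_succ']
    cases s with
    | zero =>
      obtain rfl : i = 0 := by omega
      simpa using derivWithin_add_ae hab hf hg
    | succ s =>
      exact (ae_of_eqOn (iteratedDerivWithin_congr (derivWithin_add_eqOn hab hf hg))).trans
        (ih (s := s + 1) (by omega) (hf.derivWithin hab) (hg.derivWithin hab))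

theorem iteratedDerivWithin_const_mul (i : ℕ) (c : ℂ) : ∀ (f : ℝ → ℂ),
    iteratedDerivWithin i (c • f) (Icc a b) = c • iteratedDerivWithin i f (Icc a b) := by
  induction i with
  | zero => intro f; simp
  | succ i ih =>
    intro f
    have : derivWithin (c • f) (Icc a b) = c • derivWithin f (Icc a b) := by
      ext t
      exact derivWithin_const_smul_field c f
    rw [iteratedDerivWithin_succ', iteratedDerivWithin_succ', this, ih]

theorem MemW.smul {s : ℕ} (c : ℂ) (hf : MemW a b p s f) : MemW a b p s (c • f) := by
  cases s with
  | zero => exact MemLp.const_smul hf c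
  | succ s =>
    refine ⟨hf.1.const_smul c, ?_, ?_⟩
    · rw [iteratedDerivWithin_const_mul]
      exact hf.2.1.const_smul c
    · rw [iteratedDerivWithin_const_mul]
      exact hf.2.2.const_smul c

theorem memW_zero (hab : a < b) (s : ℕ) : MemW a b p s (0 : ℝ → ℂ) := by
  have h : MemW a b p (s + 1) (0 : ℝ → ℂ) := by
    have e : ∀ i, iteratedDerivWithin i (0 : ℝ → ℂ) (Icc a b) = 0 := fun i => by
      simpa using iteratedDerivWithin_const_mul (a := a) (b := b) i 0 0
    refine ⟨contDiffOn_const, ?_, ?_⟩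
    · rw [e]
      simp [absolutelyContinuousOnInterval_iff]
      exact fun ε hε => ⟨1, one_pos, fun _ _ _ _ => hε⟩
    · rw [e]; exact MemLp.zero
  exact h.of_succ hab

theorem MemW.sum (hab : a < b) {s : ℕ} {ι : Type*} (S : Finset ι) (F : ι → ℝ → ℂ)
    (h : ∀ i ∈ S, MemW a b p s (F i)) : MemW a b p s (fun t => ∑ i ∈ S, F i t) := by
  classical
  induction S using Finset.induction_on with
  | empty => exact memW_zero hab s
  | insert i S hi ih =>
    simp only [Finset.sum_insert hi]
    exact MemW.add hab (h i (by simp)) (ih fun j hj => h j (by simp [hj]))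

/-- The product of a function of class `W^s_p` and a function of class `W^{s+1}_p` is again of
class `W^s_p`. -/
theorem MemW.mul (hab : a < b) {s : ℕ} : ∀ {f g : ℝ → ℂ}, MemW a b p s f →
    MemW a b p (s + 1) g → MemW a b p s (f * g) := by
  induction s with
  | zero =>
    intro f g hf hg
    exact MemLp.mul' (p := p) (q := ∞) (memLp_top_of_continuousOn hg.continuousOn) hf
  | succ s ih =>
    intro f g hf hg
    have key : MemW a b p s (_root_.derivWithin f (Icc a b) * g +
        f * _root_.derivWithin g (Icc a b)) := by
      refine MemW.add hab (ih (hf.derivWithin hab) (hg.of_succ hab)) ?_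
      rw [mul_comm]
      exact ih ((hg.derivWithin hab).of_succ hab) hf
    cases s with
    | zero =>
      have hg' := hg.of_succ hab
      refine memW_one.2 ⟨hf.continuousOn.mul hg.continuousOn,
        (memW_one.1 hf).2.1.smul (memW_one.1 hg').2.1, ?_⟩
      refine MemLp.ae_eq ?_ key
      filter_upwards [ae_diff hab hf, ae_diff hab hg] with t h1 h2
      exact (derivWithin_mul h1 h2).symm
    | succ s =>
      have h1 := ((memW_succ_succ hab).1 hf).1
      have h2 := ((memW_succ_succ hab).1 hg).1
      refine (memW_succ_succ hab).2 ⟨h1.mul h2, key.congr hab fun t ht => ?_⟩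
      exact (derivWithin_mul (h1 t ht) (h2 t ht)).symm

theorem iteratedDerivWithin_ae_congr (hab : a < b) {s i : ℕ} (hi : i ≤ s) (hf : MemW a b p s f)
    (hg : MemW a b p s g) (h : f =ᵐ[volume.restrict (Icc a b)] g) :
    iteratedDerivWithin i f (Icc a b) =ᵐ[volume.restrict (Icc a b)]
      iteratedDerivWithin i g (Icc a b) := by
  cases s with
  | zero =>
    obtain rfl : i = 0 := by omega
    simpa using h
  | succ s =>
    exact ae_of_eqOn (iteratedDerivWithin_congr
      (Measure.eqOn_Icc_of_ae_eq volume hab.ne h hf.continuousOn hg.continuousOn))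

end Lemmas

/-- The complex Sobolev space `W^s_p = W^s_p([a,b]; ℂ)`. A function `f` is identified with the
tuple `(f, f', …, f^{(s)})` of its derivatives (as elements of `L_p`), so that the norm is
`‖f‖_{s,p} = ∑_{k=0}^{s} ‖f^{(k)}‖_p`. -/
noncomputable def Sobolev (a b : ℝ) [hab : Fact (a < b)] (p : ℝ≥0∞) [Fact (1 ≤ p)] (s : ℕ) :
    Submodule ℂ (PiLp 1 fun _ : Fin (s + 1) => Lp ℂ p (volume.restrict (Icc a b))) where
  carrier := {d | ∃ f : ℝ → ℂ, MemW a b p s f ∧ ∀ i : Fin (s + 1),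
    d i =ᵐ[volume.restrict (Icc a b)] iteratedDerivWithin i f (Icc a b)}
  add_mem' := by
    rintro d e ⟨f, hf, hd⟩ ⟨g, hg, he⟩
    refine ⟨f + g, hf.add hab.out hg, fun i => ?_⟩
    refine (Lp.coeFn_add (d i) (e i)).trans (((hd i).add (he i)).trans ?_)
    exact (iteratedDerivWithin_add_ae hab.out (by omega) hf hg).symm
  zero_mem' := by
    refine ⟨0, memW_zero hab.out s, fun i => ?_⟩
    have e : iteratedDerivWithin i (0 : ℝ → ℂ) (Icc a b) = 0 := by
      simpa using iteratedDerivWithin_const_mul (a := a) (b := b) i 0 0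
    rw [e]
    exact Lp.coeFn_zero _ _ _
  smul_mem' := by
    rintro c d ⟨f, hf, hd⟩
    refine ⟨c • f, hf.smul c, fun i => ?_⟩
    rw [iteratedDerivWithin_const_mul]
    exact (Lp.coeFn_smul c (d i)).trans ((hd i).const_smul c)

section Space

variable {a b : ℝ} [hab : Fact (a < b)] {p : ℝ≥0∞} [Fact (1 ≤ p)] {s : ℕ}

/-- The element of `W^s_p` given by a function of class `W^s_p`. -/
noncomputable def ofFun (f : ℝ → ℂ) (hf : MemW a b p s f) : Sobolev a b p s :=
  ⟨WithLp.toLp 1 fun i => (hf.memLp hab.out (Nat.le_of_lt_succ i.2)).toLp _,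
    f, hf, fun i => MemLp.coeFn_toLp (hf.memLp hab.out (Nat.le_of_lt_succ i.2))⟩

/-- A function that represents the given element of `W^s_p`. It is unique up to a null set, and
for `s ≥ 1` its values on `[a,b]` are unique. -/
noncomputable def rep (y : Sobolev a b p s) : ℝ → ℂ := y.2.choose

theorem rep_memW (y : Sobolev a b p s) : MemW a b p s (rep y) := y.2.choose_spec.1

theorem rep_spec (y : Sobolev a b p s) (i : Fin (s + 1)) :
    y.1 i =ᵐ[volume.restrict (Icc a b)] iteratedDerivWithin i (rep y) (Icc a b) :=
  y.2.choose_spec.2 i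

theorem ofFun_congr {f g : ℝ → ℂ} (hf : MemW a b p s f) (hg : MemW a b p s g)
    (h : f =ᵐ[volume.restrict (Icc a b)] g) : ofFun f hf = ofFun g hg := by
  apply Subtype.ext
  ext1 i
  simp only [ofFun]
  rw [MemLp.toLp_eq_toLp_iff]
  exact iteratedDerivWithin_ae_congr hab.out (Nat.le_of_lt_succ i.2) hf hg h

theorem ofFun_add {f g : ℝ → ℂ} (hf : MemW a b p s f) (hg : MemW a b p s g) :
    ofFun (f + g) (hf.add hab.out hg) = ofFun f hf + ofFun g hg := by
  apply Subtype.ext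
  ext1 i
  simp only [ofFun, Submodule.coe_add, PiLp.add_apply]
  rw [← MemLp.toLp_add, MemLp.toLp_eq_toLp_iff]
  exact iteratedDerivWithin_add_ae hab.out (Nat.le_of_lt_succ i.2) hf hg

theorem ofFun_smul {f : ℝ → ℂ} (c : ℂ) (hf : MemW a b p s f) :
    ofFun (c • f) (hf.smul c) = c • ofFun f hf := by
  apply Subtype.ext
  ext1 i
  simp only [ofFun, Submodule.coe_smul, PiLp.smul_apply]
  rw [← MemLp.toLp_const_smul, MemLp.toLp_eq_toLp_iff, iteratedDerivWithin_const_mul]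

theorem rep_add (y z : Sobolev a b p s) (i : ℕ) (hi : i ≤ s) :
    iteratedDerivWithin i (rep (y + z)) (Icc a b) =ᵐ[volume.restrict (Icc a b)]
      iteratedDerivWithin i (rep y) (Icc a b) + iteratedDerivWithin i (rep z) (Icc a b) := by
  let j : Fin (s + 1) := ⟨i, by omega⟩
  exact (rep_spec (y + z) j).symm.trans
    ((Lp.coeFn_add (y.1 j) (z.1 j)).trans (((rep_spec y) j).add ((rep_spec z) j)))

theorem rep_smul (c : ℂ) (y : Sobolev a b p s) (i : ℕ) (hi : i ≤ s) :
    iteratedDerivWithin i (rep (c • y)) (Icc a b) =ᵐ[volume.restrict (Icc a b)]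
      c • iteratedDerivWithin i (rep y) (Icc a b) := by
  let j : Fin (s + 1) := ⟨i, by omega⟩
  exact ((rep_spec (c • y)) j).symm.trans
    ((Lp.coeFn_smul c (y.1 j)).trans (((rep_spec y) j).const_smul c))

end Space

/-- The space `(W^s_p)^m` of vector-valued functions; its norm is the sum of the norms of the
components. -/
abbrev SobolevVec (a b : ℝ) [Fact (a < b)] (p : ℝ≥0∞) [Fact (1 ≤ p)] (s m : ℕ) : Type :=
  PiLp 1 fun _ : Fin m => Sobolev a b p s

section Operators

variable {a b : ℝ} [hab : Fact (a < b)] {p : ℝ≥0∞} [Fact (1 ≤ p)] {n m r l : ℕ}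

/-- The `i`-th component of `(Ly)(t) = y^{(r)}(t) + ∑_{j=0}^{r-1} A_j(t) y^{(j)}(t)`. -/
noncomputable def diffExpr (A : Fin r → Matrix (Fin m) (Fin m) (Sobolev a b p n))
    (y : SobolevVec a b p (n + r) m) (i : Fin m) (t : ℝ) : ℂ :=
  iteratedDerivWithin r (rep (y i)) (Icc a b) t +
    ∑ j : Fin r, ∑ q : Fin m, (rep (A j i q)) t * iteratedDerivWithin j (rep (y q)) (Icc a b) t

theorem diffExpr_memW (A : Fin r → Matrix (Fin m) (Fin m) (Sobolev a b p n))
    (y : SobolevVec a b p (n + r) m) (i : Fin m) : MemW a b p n (diffExpr A y i) := by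
  refine MemW.add hab.out ((rep_memW (y i)).iteratedDerivWithin hab.out r) ?_
  refine MemW.sum hab.out _ _ fun j _ => MemW.sum hab.out _ _ fun q _ => ?_
  refine MemW.mul hab.out (rep_memW (A j i q)) ?_
  exact MemW.iteratedDerivWithin hab.out j ((rep_memW (y q)).of_le hab.out (by omega))

/-- The differential operator `L : (W^{n+r}_p)^m → (W^n_p)^m` with coefficients
`A_0, …, A_{r-1}` in `(W^n_p)^{m×m}`. -/
noncomputable def diffOp (A : Fin r → Matrix (Fin m) (Fin m) (Sobolev a b p n)) :
    SobolevVec a b p (n + r) m →ₗ[ℂ] SobolevVec a b p n m where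
  toFun y := WithLp.toLp 1 fun i => ofFun (diffExpr A y i) (diffExpr_memW A y i)
  map_add' y z := by
    ext1 i
    simp only [PiLp.add_apply]
    rw [← ofFun_add]
    apply ofFun_congr
    have h : ∀ᵐ t ∂(volume.restrict (Icc a b)), ∀ (j : Fin (r + 1)) (q : Fin m),
        iteratedDerivWithin j (rep (y q + z q)) (Icc a b) t =
          iteratedDerivWithin j (rep (y q)) (Icc a b) t
            + iteratedDerivWithin j (rep (z q)) (Icc a b) t :=
      ae_all_iff.2 fun j => ae_all_iff.2 fun q => rep_add (y q) (z q) j (by omega)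
    filter_upwards [h] with t ht
    have h1 := ht (Fin.last r) i
    have h2 : ∀ (j : Fin r) (q : Fin m), _ := fun j q => ht j.castSucc q
    simp only [Fin.val_last, Fin.val_castSucc] at h1 h2
    simp only [diffExpr, Pi.add_apply, PiLp.add_apply, h1, h2, mul_add, Finset.sum_add_distrib]
    ring
  map_smul' c y := by
    ext1 i
    simp only [PiLp.smul_apply, RingHom.id_apply]
    rw [← ofFun_smul]
    apply ofFun_congr
    have h : ∀ᵐ t ∂(volume.restrict (Icc a b)), ∀ (j : Fin (r + 1)) (q : Fin m),
        iteratedDerivWithin j (rep (c • y q)) (Icc a b) t =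
          c * iteratedDerivWithin j (rep (y q)) (Icc a b) t :=
      ae_all_iff.2 fun j => ae_all_iff.2 fun q => rep_smul c (y q) j (by omega)
    filter_upwards [h] with t ht
    have h1 := ht (Fin.last r) i
    have h2 : ∀ (j : Fin r) (q : Fin m), _ := fun j q => ht j.castSucc q
    simp only [Fin.val_last, Fin.val_castSucc] at h1 h2
    simp only [diffExpr, Pi.smul_apply, PiLp.smul_apply, h1, h2, smul_eq_mul, mul_add,
      Finset.mul_sum, mul_left_comm]

/-- `Y`, given by its columns `Y 0, …, Y (m-1)` in `(W^{n+r}_p)^m`, solves the `i`-th matrix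
Cauchy problem (with `i ∈ {0, …, r-1}`):
`Y^{(r)} + ∑_{j=0}^{r-1} A_j Y^{(j)} = 0` and `Y^{(j)}(a) = δ_{i,j} I_m` for `0 ≤ j < r`. -/
def IsCauchySolution (A : Fin r → Matrix (Fin m) (Fin m) (Sobolev a b p n)) (i : Fin r)
    (Y : Fin m → SobolevVec a b p (n + r) m) : Prop :=
  (∀ c : Fin m, diffOp A (Y c) = 0) ∧
  ∀ (j : Fin r) (q c : Fin m), iteratedDerivWithin j (rep (Y c q)) (Icc a b) a =
    (if i = j then (1 : Matrix (Fin m) (Fin m) ℂ) else 0) q c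

/-- The solution `Y_i` of the `i`-th matrix Cauchy problem, given by its columns. -/
noncomputable def cauchySolution (A : Fin r → Matrix (Fin m) (Fin m) (Sobolev a b p n))
    (i : Fin r) : Fin m → SobolevVec a b p (n + r) m :=
  Classical.epsilon (IsCauchySolution A i)

/-- The characteristic matrix `M(L,B) = ([BY_1], …, [BY_r]) ∈ ℂ^{l × rm}`. The columns are
indexed by pairs (number of the block, number of the column in the block). -/
noncomputable def charMatrix (A : Fin r → Matrix (Fin m) (Fin m) (Sobolev a b p n))
    (B : SobolevVec a b p (n + r) m →L[ℂ] (Fin l → ℂ)) :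
    Matrix (Fin l) (Fin r × Fin m) ℂ :=
  Matrix.of fun q ic => B (cauchySolution A ic.1 ic.2) q

/-- The operator `(L,B) : (W^{n+r}_p)^m → (W^n_p)^m × ℂ^l`. -/
noncomputable def bvpOp (A : Fin r → Matrix (Fin m) (Fin m) (Sobolev a b p n))
    (B : SobolevVec a b p (n + r) m →L[ℂ] (Fin l → ℂ)) :
    SobolevVec a b p (n + r) m →ₗ[ℂ] SobolevVec a b p n m × (Fin l → ℂ) :=
  (diffOp A).prod B.toLinearMap

end Operators

end BVP

/-!
The characteristic matrix of a strongly convergent sequence of problems converges because, besides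
the operators `B(k)`, also the columns of the solutions `Y_i(·, k)` converge, namely in
`(W^{n+r}_p)^m`.

Strong convergence determines the coefficients. On the test functions `(t - a)^d / d!`, placed
in one component, `L(k)` gives its coefficient with the index `d` plus a combination of the
coefficients with smaller indices. As multiplication is continuous from `W^n_p × W^{n+1}_p` to
`W^n_p` (`TendstoW.mul`), induction on `d` shows that the coefficients converge in `W^n_p`
(`tendstoW_coeff`).

The Cauchy problem is rewritten as the integral equation `z = c + K z` for
`z = (y, y', …, y^{(r-1)})`, where `K` is the Volterra operator on continuous functions with the
companion matrix as its integrable coefficient. Since `‖K^N‖ ≤ (∫ ‖𝒜‖)^N / N!`, the operator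
`1 - K` is invertible (`isUnit_one_sub_volterra`), which gives existence and uniqueness. As `K`
depends continuously in norm on its coefficient in `L_1` and inversion is continuous, the
solutions converge uniformly. The differential equation itself then improves the convergence step
by step to convergence in `W^{n+r}_p` (`tendstoW_component_of_isVolterraSolution`); with constant
sequences, the same argument gives the regularity of a single solution.

The Sobolev spaces are complete (`exists_memW_of_tendsto`), so the Banach–Steinhaus theorem bounds
the norms of the `B(k)`, and `B(k) Y_i(·, k) → B Y_i` follows from strong convergence.

Convergence is handled on the level of functions, by `TendstoW`. This avoids explicit constants in
the product estimate and fits the recursion `‖f‖_{s+1,p} = ‖f‖_p + ‖f'‖_{s,p}`.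
-/

namespace BVP

/-! ### Primitives and products of Sobolev functions -/

section Calculus

variable {a b : ℝ} {p : ℝ≥0∞} {f g h : ℝ → ℂ} {s : ℕ}

theorem intervalIntegrable_of_memLp (hab : a < b) (hp : 1 ≤ p)
    (hf : MemLp f p (volume.restrict (Icc a b))) : IntervalIntegrable f volume a b := by
  rw [intervalIntegrable_iff_integrableOn_Icc_of_le hab.le]
  exact hf.integrable hp

theorem intervalIntegrable_of_mem_Icc {E : Type*} [NormedAddCommGroup E] {f : ℝ → E}
    (hf : IntervalIntegrable f volume a b) {x y : ℝ}
    (hx : x ∈ Icc a b) (hy : y ∈ Icc a b) : IntervalIntegrable f volume x y := by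
  refine hf.mono_set ?_
  rw [uIcc_of_le (hx.1.trans hx.2)]
  exact uIcc_subset_Icc hx hy

theorem absolutelyContinuousOnInterval_integral (hf : IntervalIntegrable f volume a b)
    (hab : a < b) : AbsolutelyContinuousOnInterval (fun t => ∫ s in a..t, f s) a b := by
  have h := hf.norm.absolutelyContinuousOnInterval_intervalIntegral (c := a) left_mem_uIcc
  rw [absolutelyContinuousOnInterval_iff] at h ⊢
  intro ε hε
  obtain ⟨δ, hδ, H⟩ := h ε hε
  refine ⟨δ, hδ, fun E hE hE' => lt_of_le_of_lt (Finset.sum_le_sum fun i hi => ?_) (H E hE hE')⟩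
  have h1 := (hE.1 i hi).1
  have h2 := (hE.1 i hi).2
  rw [uIcc_of_le hab.le] at h1 h2
  have ha : a ∈ Icc a b := left_mem_Icc.2 hab.le
  rw [dist_eq_norm, dist_eq_norm,
    intervalIntegral.integral_interval_sub_left (intervalIntegrable_of_mem_Icc hf ha h1)
      (intervalIntegrable_of_mem_Icc hf ha h2),
    intervalIntegral.integral_interval_sub_left (intervalIntegrable_of_mem_Icc hf.norm ha h1)
      (intervalIntegrable_of_mem_Icc hf.norm ha h2)]
  exact intervalIntegral.norm_integral_le_abs_integral_norm

theorem ae_mem_Ioo (a b : ℝ) : ∀ᵐ t ∂(volume.restrict (Icc a b)), t ∈ Ioo a b := by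
  rw [← restrict_Ioo_eq_restrict_Icc]
  exact ae_restrict_mem measurableSet_Ioo

theorem absolutelyContinuousOnInterval_const (c : ℂ) :
    AbsolutelyContinuousOnInterval (fun _ => c) a b := by
  simp [absolutelyContinuousOnInterval_iff]
  exact fun ε hε => ⟨1, one_pos, fun _ _ _ _ => hε⟩

/-- The primitive `t ↦ c + ∫_a^t f` of `f` with the value `c` at `a`. -/
noncomputable def primitive (a : ℝ) (c : ℂ) (f : ℝ → ℂ) (t : ℝ) : ℂ := c + ∫ s in a..t, f s

@[simp] theorem primitive_left (c : ℂ) : primitive a c f a = c := by simp [primitive]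

theorem absolutelyContinuousOnInterval_primitive (hab : a < b)
    (hf : IntervalIntegrable f volume a b) (c : ℂ) :
    AbsolutelyContinuousOnInterval (primitive a c f) a b :=
  (absolutelyContinuousOnInterval_const c).add (absolutelyContinuousOnInterval_integral hf hab)

theorem ae_hasDerivAt_primitive (hab : a < b) (hf : IntervalIntegrable f volume a b) (c : ℂ) :
    ∀ᵐ t ∂(volume.restrict (Icc a b)), HasDerivAt (primitive a c f) (f t) t := by
  rw [ae_restrict_iff' measurableSet_Icc]
  filter_upwards [hf.ae_hasDerivAt_integral] with t ht hmem
  rw [uIcc_of_le hab.le] at ht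
  exact (ht hmem a (left_mem_Icc.2 hab.le)).const_add c

theorem derivWithin_primitive_ae (hab : a < b) (hf : IntervalIntegrable f volume a b) (c : ℂ) :
    derivWithin (primitive a c f) (Icc a b) =ᵐ[volume.restrict (Icc a b)] f := by
  filter_upwards [ae_hasDerivAt_primitive hab hf c, ae_restrict_mem measurableSet_Icc]
    with t ht hmem
  exact ht.hasDerivWithinAt.derivWithin (uniqueDiffOn_Icc hab t hmem)

theorem hasDerivWithinAt_primitive (hf : ContinuousOn f (Icc a b)) (c : ℂ) {t : ℝ}
    (ht : t ∈ Icc a b) : HasDerivWithinAt (primitive a c f) (f t) (Icc a b) t := by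
  have : Fact (t ∈ Icc a b) := ⟨ht⟩
  refine HasDerivWithinAt.const_add c (intervalIntegral.integral_hasDerivWithinAt_right ?_
    ?_ (hf t ht))
  · exact (hf.mono (Icc_subset_Icc_right ht.2)).intervalIntegrable_of_Icc ht.1
  · exact ⟨Icc a b, self_mem_nhdsWithin, hf.aestronglyMeasurable measurableSet_Icc⟩

theorem MemW.primitive (hab : a < b) (hp : 1 ≤ p) (hf : MemW a b p s f) (c : ℂ) :
    MemW a b p (s + 1) (primitive a c f) := by
  have hi := intervalIntegrable_of_memLp hab hp (hf.of_le hab (Nat.zero_le s))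
  cases s with
  | zero =>
    have hac := absolutelyContinuousOnInterval_primitive hab hi c
    refine memW_one.2 ⟨?_, hac, MemLp.ae_eq (derivWithin_primitive_ae hab hi c).symm hf⟩
    simpa [uIcc_of_le hab.le] using hac.continuousOn
  | succ s =>
    refine (memW_succ_succ hab).2 ⟨fun t ht =>
      (hasDerivWithinAt_primitive hf.continuousOn c ht).differentiableWithinAt, ?_⟩
    refine hf.congr hab fun t ht => ?_
    exact ((hasDerivWithinAt_primitive hf.continuousOn c ht).derivWithin
      (uniqueDiffOn_Icc hab t ht)).symm

/-- Functions of class `W^1_p` are the primitives of their derivatives. -/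
theorem MemW.eq_primitive (hab : a < b) (hp : 1 ≤ p) (hf : MemW a b p (s + 1) f) :
    EqOn f (BVP.primitive a (f a) (_root_.derivWithin f (Icc a b))) (Icc a b) := by
  have hf1 := memW_one.1 (hf.of_le hab (show 1 ≤ s + 1 by omega))
  have hi := intervalIntegrable_of_memLp hab hp hf1.2.2
  have hac := hf1.2.1.sub (absolutelyContinuousOnInterval_primitive hab hi (f a))
  obtain ⟨C, hC⟩ := hac.const_of_ae_hasDerivAt_zero (by
    rw [uIcc_of_le hab.le, ← ae_restrict_iff' measurableSet_Icc]
    filter_upwards [ae_hasDerivAt_primitive hab hi (f a), ae_diff hab hf, ae_mem_Ioo a b]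
      with t h1 h2 h3
    have := (h2.hasDerivWithinAt.hasDerivAt (Icc_mem_nhds h3.1 h3.2)).sub h1
    simpa using this)
  rw [uIcc_of_le hab.le] at hC
  have h0 := hC a (left_mem_Icc.2 hab.le)
  simp at h0
  intro t ht
  have := hC t ht
  rw [← h0] at this
  simpa [sub_eq_zero] using this

/-- `W^{s+1}_p` is closed under multiplication. -/
theorem MemW.mul_self (hab : a < b) (hf : MemW a b p (s + 1) f) (hg : MemW a b p (s + 1) g) :
    MemW a b p (s + 1) (f * g) ∧
    _root_.derivWithin (f * g) (Icc a b) =ᵐ[volume.restrict (Icc a b)]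
      _root_.derivWithin f (Icc a b) * g + f * _root_.derivWithin g (Icc a b) := by
  have hae : _root_.derivWithin (f * g) (Icc a b) =ᵐ[volume.restrict (Icc a b)]
      _root_.derivWithin f (Icc a b) * g + f * _root_.derivWithin g (Icc a b) := by
    filter_upwards [ae_diff hab hf, ae_diff hab hg] with t h1 h2
    exact derivWithin_mul h1 h2
  refine ⟨?_, hae⟩
  have key : MemW a b p s (_root_.derivWithin f (Icc a b) * g +
      f * _root_.derivWithin g (Icc a b)) := by
    refine MemW.add hab (MemW.mul hab (hf.derivWithin hab) hg) ?_
    rw [mul_comm]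
    exact MemW.mul hab (hg.derivWithin hab) hf
  cases s with
  | zero =>
    exact memW_one.2 ⟨hf.continuousOn.mul hg.continuousOn,
      (memW_one.1 hf).2.1.smul (memW_one.1 hg).2.1, MemLp.ae_eq hae.symm key⟩
  | succ s =>
    have h1 := ((memW_succ_succ hab).1 hf).1
    have h2 := ((memW_succ_succ hab).1 hg).1
    refine (memW_succ_succ hab).2 ⟨h1.mul h2, key.congr hab fun t ht => ?_⟩
    exact (derivWithin_mul (h1 t ht) (h2 t ht)).symm

end Calculus

/-! ### Convergence in Sobolev spaces -/

section Convergence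

/-- Convergence `F k → f` in `W^s_p` of a sequence of functions of class `W^s_p`: all derivatives
up to the order `s` converge in `L_p`. For `s = 0` and `p = ∞` and continuous functions, this is
uniform convergence. -/
def TendstoW (a b : ℝ) (p : ℝ≥0∞) (s : ℕ) (F : ℕ → ℝ → ℂ) (f : ℝ → ℂ) : Prop :=
  (∀ k, MemW a b p s (F k)) ∧ MemW a b p s f ∧ ∀ i ≤ s,
    Tendsto (fun k => eLpNorm (iteratedDerivWithin i (F k) (Icc a b) -
      iteratedDerivWithin i f (Icc a b)) p (volume.restrict (Icc a b))) atTop (𝓝 0)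

variable {a b : ℝ} {p : ℝ≥0∞} {F G H : ℕ → ℝ → ℂ} {f g h : ℝ → ℂ} {s : ℕ}

theorem tendstoW_zero_iff : TendstoW a b p 0 F f ↔
    (∀ k, MemLp (F k) p (volume.restrict (Icc a b))) ∧ MemLp f p (volume.restrict (Icc a b)) ∧
      Tendsto (fun k => eLpNorm (F k - f) p (volume.restrict (Icc a b))) atTop (𝓝 0) := by
  simp [TendstoW, MemW]

theorem tendstoW_succ_iff (hab : a < b) : TendstoW a b p (s + 1) F f ↔
    (∀ k, MemW a b p (s + 1) (F k)) ∧ MemW a b p (s + 1) f ∧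
      TendstoW a b p 0 F f ∧
      TendstoW a b p s (fun k => derivWithin (F k) (Icc a b)) (derivWithin f (Icc a b)) := by
  constructor
  · rintro ⟨h1, h2, h3⟩
    refine ⟨h1, h2, tendstoW_zero_iff.2 ⟨fun k => (h1 k).of_le hab (Nat.zero_le _),
      h2.of_le hab (Nat.zero_le _), by simpa using h3 0 (by omega)⟩,
      fun k => (h1 k).derivWithin hab, h2.derivWithin hab, fun i hi => ?_⟩
    simpa only [iteratedDerivWithin_succ'] using h3 (i + 1) (by omega)
  · rintro ⟨h1, h2, h3, h4⟩
    refine ⟨h1, h2, fun i hi => ?_⟩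
    cases i with
    | zero => simpa using (tendstoW_zero_iff.1 h3).2.2
    | succ i => simpa only [iteratedDerivWithin_succ'] using h4.2.2 i (by omega)

theorem tendstoW_const (hf : MemW a b p s f) : TendstoW a b p s (fun _ => f) f :=
  ⟨fun _ => hf, hf, fun i _ => by simp⟩

theorem TendstoW.of_le (hab : a < b) {t : ℕ} (hts : t ≤ s) (hF : TendstoW a b p s F f) :
    TendstoW a b p t F f :=
  ⟨fun k => (hF.1 k).of_le hab hts, hF.2.1.of_le hab hts, fun i hi => hF.2.2 i (hi.trans hts)⟩

theorem TendstoW.congr (hab : a < b) (hF : TendstoW a b p s F f)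
    (hG : ∀ k, MemW a b p s (G k)) (hg : MemW a b p s g)
    (h1 : ∀ k, F k =ᵐ[volume.restrict (Icc a b)] G k) (h2 : f =ᵐ[volume.restrict (Icc a b)] g) :
    TendstoW a b p s G g := by
  refine ⟨hG, hg, fun i hi => ?_⟩
  refine (hF.2.2 i hi).congr fun k => eLpNorm_congr_ae ?_
  exact (iteratedDerivWithin_ae_congr hab hi (hF.1 k) (hG k) (h1 k)).sub
    (iteratedDerivWithin_ae_congr hab hi hF.2.1 hg h2)

theorem TendstoW.congr_eqOn (hab : a < b) (hF : TendstoW a b p s F f)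
    (h1 : ∀ k, EqOn (F k) (G k) (Icc a b)) (h2 : EqOn f g (Icc a b)) :
    TendstoW a b p s G g :=
  hF.congr hab (fun k => (hF.1 k).congr hab (h1 k)) (hF.2.1.congr hab h2)
    (fun k => ae_of_eqOn (h1 k)) (ae_of_eqOn h2)

theorem TendstoW.add (hab : a < b) (hp : 1 ≤ p) (hF : TendstoW a b p s F f)
    (hG : TendstoW a b p s G g) : TendstoW a b p s (fun k => F k + G k) (f + g) := by
  refine ⟨fun k => (hF.1 k).add hab (hG.1 k), hF.2.1.add hab hG.2.1, fun i hi => ?_⟩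
  have h0 := (hF.2.2 i hi).add (hG.2.2 i hi)
  rw [add_zero] at h0
  refine tendsto_of_tendsto_of_tendsto_of_le_of_le tendsto_const_nhds h0 (fun _ => zero_le)
    fun k => ?_
  have e : iteratedDerivWithin i (F k + G k) (Icc a b) - iteratedDerivWithin i (f + g) (Icc a b)
      =ᵐ[volume.restrict (Icc a b)]
      (iteratedDerivWithin i (F k) (Icc a b) - iteratedDerivWithin i f (Icc a b)) +
      (iteratedDerivWithin i (G k) (Icc a b) - iteratedDerivWithin i g (Icc a b)) := by
    filter_upwards [iteratedDerivWithin_add_ae hab hi (hF.1 k) (hG.1 k),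
      iteratedDerivWithin_add_ae hab hi hF.2.1 hG.2.1] with t h1 h2
    simp only [Pi.sub_apply, Pi.add_apply] at *
    rw [h1, h2]; ring
  dsimp only
  rw [eLpNorm_congr_ae e]
  exact eLpNorm_add_le (((hF.1 k).memLp hab hi).sub (hF.2.1.memLp hab hi)).1
    (((hG.1 k).memLp hab hi).sub (hG.2.1.memLp hab hi)).1 hp

theorem TendstoW.smul (c : ℂ) (hF : TendstoW a b p s F f) :
    TendstoW a b p s (fun k => c • F k) (c • f) := by
  refine ⟨fun k => (hF.1 k).smul c, hF.2.1.smul c, fun i hi => ?_⟩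
  have h0 := ENNReal.Tendsto.const_mul (a := ‖c‖ₑ) (hF.2.2 i hi) (Or.inr (by simp))
  rw [mul_zero] at h0
  refine h0.congr fun k => ?_
  rw [iteratedDerivWithin_const_mul, iteratedDerivWithin_const_mul, ← smul_sub,
    eLpNorm_const_smul]

theorem TendstoW.sum (hab : a < b) (hp : 1 ≤ p) {ι : Type*} (S : Finset ι) {F : ι → ℕ → ℝ → ℂ}
    {f : ι → ℝ → ℂ} (h : ∀ i ∈ S, TendstoW a b p s (F i) (f i)) :
    TendstoW a b p s (fun k t => ∑ i ∈ S, F i k t) (fun t => ∑ i ∈ S, f i t) := by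
  classical
  induction S using Finset.induction_on with
  | empty => exact tendstoW_const (memW_zero hab s)
  | insert i S hi ih =>
    simp only [Finset.sum_insert hi]
    exact TendstoW.add hab hp (h i (by simp)) (ih fun j hj => h j (by simp [hj]))

theorem TendstoW.mono_exponent {q : ℝ≥0∞} (hpq : p ≤ q) (hF : TendstoW a b q 0 F f) :
    TendstoW a b p 0 F f := by
  rw [tendstoW_zero_iff] at hF ⊢
  refine ⟨fun k => (hF.1 k).mono_exponent hpq, hF.2.1.mono_exponent hpq, ?_⟩
  set C : ℝ≥0∞ := (volume.restrict (Icc a b)) univ ^ (1 / p.toReal - 1 / q.toReal) with hC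
  by_cases hp0 : p = 0
  · simp [hp0]
  have h0 := ENNReal.Tendsto.mul_const (b := C) hF.2.2 (Or.inr (by
    refine (ENNReal.rpow_lt_top_of_nonneg ?_ (measure_ne_top _ _)).ne
    by_cases hq : q = ∞
    · simp [hq]
    have hp' : 0 < p.toReal := ENNReal.toReal_pos hp0 (ne_top_of_le_ne_top hq hpq)
    have := ENNReal.toReal_mono hq hpq
    rw [sub_nonneg]
    exact one_div_le_one_div_of_le hp' this))
  rw [zero_mul] at h0
  refine tendsto_of_tendsto_of_tendsto_of_le_of_le tendsto_const_nhds h0 (fun _ => zero_le)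
    fun k => ?_
  exact eLpNorm_le_eLpNorm_mul_rpow_measure_univ hpq ((hF.1 k).sub hF.2.1).1

theorem TendstoW.mul_top (hp : 1 ≤ p) (hF : TendstoW a b p 0 F f) (hG : TendstoW a b ∞ 0 G g) :
    TendstoW a b p 0 (fun k => F k * G k) (f * g) := by
  rw [tendstoW_zero_iff] at hF hG ⊢
  refine ⟨fun k => (hG.1 k).mul' (p := p) (q := ∞) (hF.1 k), hG.2.1.mul' (p := p) (q := ∞) hF.2.1,
    ?_⟩
  have h0 := (((ENNReal.Tendsto.mul hF.2.2 (by simp) hG.2.2 (by simp)).add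
    (ENNReal.Tendsto.const_mul (a := eLpNorm f p (volume.restrict (Icc a b))) hG.2.2
      (Or.inr hF.2.1.eLpNorm_ne_top))).add
    (ENNReal.Tendsto.mul_const (b := eLpNorm g ∞ (volume.restrict (Icc a b))) hF.2.2
      (Or.inr hG.2.1.eLpNorm_ne_top)))
  simp only [mul_zero, zero_mul, add_zero] at h0
  refine tendsto_of_tendsto_of_tendsto_of_le_of_le tendsto_const_nhds h0 (fun _ => zero_le)
    fun k => ?_
  -- scalar multiplication in place of `*`, to match the Hölder inequality of Mathlib
  have e : F k * G k - f * g = (F k - f) • (G k - g) + f • (G k - g) + (F k - f) • g := by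
    simp only [smul_eq_mul]; ring
  have m1 := (hF.1 k).sub hF.2.1
  have m2 := (hG.1 k).sub hG.2.1
  dsimp only
  rw [e]
  refine (eLpNorm_add_le ((m1.1.smul m2.1).add (hF.2.1.1.smul m2.1)) (m1.1.smul hG.2.1.1)
    hp).trans (add_le_add ((eLpNorm_add_le (m1.1.smul m2.1) (hF.2.1.1.smul m2.1) hp).trans
    (add_le_add ?_ ?_)) ?_)
  · exact eLpNorm_smul_le_eLpNorm_mul_eLpNorm_top p _ m1.1
  · exact eLpNorm_smul_le_eLpNorm_mul_eLpNorm_top p _ hF.2.1.1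
  · exact eLpNorm_smul_le_eLpNorm_mul_eLpNorm_top p _ m1.1

theorem enorm_intervalIntegral_le {E : Type*} [NormedAddCommGroup E] [NormedSpace ℝ E]
    (h : ℝ → E) {x y : ℝ} (hx : x ∈ Icc a b) (hy : y ∈ Icc a b) :
    ‖∫ s in x..y, h s‖ₑ ≤ eLpNorm h 1 (volume.restrict (Icc a b)) := by
  rw [eLpNorm_one_eq_lintegral_enorm]
  have e : ‖∫ s in x..y, h s‖ₑ = ‖∫ s in uIoc x y, h s‖ₑ := by
    rw [← ofReal_norm, ← ofReal_norm, intervalIntegral.norm_intervalIntegral_eq]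
  rw [e]
  refine (enorm_integral_le_lintegral_enorm _).trans (lintegral_mono_set ?_)
  exact uIoc_subset_uIcc.trans (uIcc_subset_Icc hx hy)

theorem eLpNorm_top_le_of_forall {C : ℝ≥0∞} (h : ∀ t ∈ Icc a b, ‖f t‖ₑ ≤ C) :
    eLpNorm f ∞ (volume.restrict (Icc a b)) ≤ C := by
  rw [eLpNorm_exponent_top]
  refine eLpNormEssSup_le_of_ae_enorm_bound ?_
  filter_upwards [ae_restrict_mem measurableSet_Icc] with t ht using h t ht

/-- The embedding of `W^1_p` into the space of continuous functions: averaging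
`f(t) = f(x) + ∫_x^t f'` over `x` bounds `f(t)` by the `L_1` norms of `f` and `f'`. -/
theorem MemW.enorm_le (hab : a < b) (hp : 1 ≤ p) (hf : MemW a b p (s + 1) f) {t : ℝ}
    (ht : t ∈ Icc a b) : ‖f t‖ₑ ≤
      (volume (Icc a b))⁻¹ * eLpNorm f 1 (volume.restrict (Icc a b)) +
        eLpNorm (_root_.derivWithin f (Icc a b)) 1 (volume.restrict (Icc a b)) := by
  set D := eLpNorm (_root_.derivWithin f (Icc a b)) 1 (volume.restrict (Icc a b)) with hD
  have hi := intervalIntegrable_of_memLp hab hp (memW_one.1 (hf.of_le hab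
    (show 1 ≤ s + 1 by omega))).2.2
  have ha : a ∈ Icc a b := left_mem_Icc.2 hab.le
  have h1 : ∀ x ∈ Icc a b, ‖f t‖ₑ ≤ ‖f x‖ₑ + D := by
    intro x hx
    have e : f t = f x + ∫ s in x..t, _root_.derivWithin f (Icc a b) s := by
      rw [hf.eq_primitive hab hp ht, hf.eq_primitive hab hp hx, BVP.primitive, BVP.primitive,
        add_assoc, intervalIntegral.integral_add_adjacent_intervals
          (intervalIntegrable_of_mem_Icc hi ha hx) (intervalIntegrable_of_mem_Icc hi hx ht)]
    rw [e]
    exact (enorm_add_le _ _).trans (add_le_add le_rfl (enorm_intervalIntegral_le _ hx ht))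
  have h2 := setLIntegral_mono' (μ := volume) measurableSet_Icc h1
  rw [lintegral_add_right _ measurable_const, lintegral_const, lintegral_const,
    ← eLpNorm_one_eq_lintegral_enorm] at h2
  simp only [Measure.restrict_apply_univ] at h2
  have hv0 : volume (Icc a b) ≠ 0 := by simp [hab]
  have hvt : volume (Icc a b) ≠ ∞ := by simp
  calc ‖f t‖ₑ = (volume (Icc a b))⁻¹ * (‖f t‖ₑ * volume (Icc a b)) := by
        rw [mul_comm ‖f t‖ₑ, ← mul_assoc, ENNReal.inv_mul_cancel hv0 hvt, one_mul]
    _ ≤ (volume (Icc a b))⁻¹ * (eLpNorm f 1 (volume.restrict (Icc a b)) +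
          D * volume (Icc a b)) := by
        gcongr
    _ = _ := by
        rw [mul_add, mul_comm D, ← mul_assoc, ENNReal.inv_mul_cancel hv0 hvt, one_mul]

theorem TendstoW.sub_limit (hab : a < b) (hp : 1 ≤ p) (hF : TendstoW a b p s F f) :
    TendstoW a b p s (fun k => F k - f) 0 := by
  have h := hF.add hab hp ((tendstoW_const hF.2.1).smul (-1 : ℂ))
  refine h.congr_eqOn hab (fun k t _ => ?_) fun t _ => ?_ <;> simp [sub_eq_add_neg]

/-- Convergence in `W^{s+1}_p` implies uniform convergence. -/
theorem TendstoW.uniform (hab : a < b) (hp : 1 ≤ p) (hF : TendstoW a b p (s + 1) F f) :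
    TendstoW a b ∞ 0 F f := by
  rw [tendstoW_zero_iff]
  refine ⟨fun k => memLp_top_of_continuousOn (hF.1 k).continuousOn,
    memLp_top_of_continuousOn hF.2.1.continuousOn, ?_⟩
  have hd := hF.sub_limit hab hp
  obtain ⟨-, -, h1, h2⟩ := (tendstoW_succ_iff hab).1 hd
  have h1' := (tendstoW_zero_iff.1 (h1.mono_exponent hp)).2.2
  have h2' := (tendstoW_zero_iff.1 ((h2.of_le hab (Nat.zero_le _)).mono_exponent hp)).2.2
  have h0 := (ENNReal.Tendsto.const_mul (a := (volume (Icc a b))⁻¹) h1'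
    (Or.inr (by simp [hab]))).add h2'
  rw [mul_zero, add_zero] at h0
  refine tendsto_of_tendsto_of_tendsto_of_le_of_le tendsto_const_nhds h0 (fun _ => zero_le)
    fun k => eLpNorm_top_le_of_forall fun t ht => ?_
  have := (hd.1 k).enorm_le hab hp ht
  have e : derivWithin (0 : ℝ → ℂ) (Icc a b) = 0 := by ext; simp
  simpa [e] using this

/-- Integration is continuous from `W^s_p` to `W^{s+1}_p`, jointly with the initial value. -/
theorem TendstoW.primitive (hab : a < b) (hp : 1 ≤ p) {c : ℕ → ℂ} {c₀ : ℂ}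
    (hc : Tendsto c atTop (𝓝 c₀)) (hF : TendstoW a b p s F f) :
    TendstoW a b p (s + 1) (fun k => primitive a (c k) (F k)) (primitive a c₀ f) := by
  have hm : ∀ k, MemW a b p (s + 1) (BVP.primitive a (c k) (F k)) := fun k =>
    (hF.1 k).primitive hab hp (c k)
  have hm0 := hF.2.1.primitive hab hp c₀
  have hi : ∀ k, IntervalIntegrable (F k) volume a b := fun k =>
    intervalIntegrable_of_memLp hab hp ((hF.1 k).of_le hab (Nat.zero_le s))
  have hi0 := intervalIntegrable_of_memLp hab hp (hF.2.1.of_le hab (Nat.zero_le s))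
  refine (tendstoW_succ_iff hab).2 ⟨hm, hm0, TendstoW.mono_exponent (q := ∞) le_top ?_,
    hF.congr hab (fun k => (hm k).derivWithin hab) (hm0.derivWithin hab)
      (fun k => (derivWithin_primitive_ae hab (hi k) (c k)).symm)
      (derivWithin_primitive_ae hab hi0 c₀).symm⟩
  rw [tendstoW_zero_iff]
  refine ⟨fun k => memLp_top_of_continuousOn (hm k).continuousOn,
    memLp_top_of_continuousOn hm0.continuousOn, ?_⟩
  have h1 := (tendstoW_zero_iff.1 ((hF.of_le hab (Nat.zero_le _)).mono_exponent hp)).2.2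
  have h2 : Tendsto (fun k => ‖c k - c₀‖ₑ) atTop (𝓝 0) := by
    have := (hc.sub_const c₀).enorm
    simpa using this
  have h0 := h2.add h1
  rw [add_zero] at h0
  refine tendsto_of_tendsto_of_tendsto_of_le_of_le tendsto_const_nhds h0 (fun _ => zero_le)
    fun k => eLpNorm_top_le_of_forall fun t ht => ?_
  have ha : a ∈ Icc a b := left_mem_Icc.2 hab.le
  have e : (BVP.primitive a (c k) (F k) - BVP.primitive a c₀ f) t =
      (c k - c₀) + ∫ s in a..t, (F k - f) s := by
    simp only [Pi.sub_apply, BVP.primitive]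
    rw [intervalIntegral.integral_sub (intervalIntegrable_of_mem_Icc (hi k) ha ht)
      (intervalIntegrable_of_mem_Icc hi0 ha ht)]
    ring
  rw [e]
  exact (enorm_add_le _ _).trans (add_le_add le_rfl (enorm_intervalIntegral_le _ ha ht))

/-- The product rule turns continuity of multiplication `W^s_p × W^{s+1}_p → W^s_p` into continuity
of multiplication on `W^{s+1}_p`. -/
theorem TendstoW.mul_self_of_mul (hab : a < b) (hp : 1 ≤ p)
    (hmul : ∀ {F G : ℕ → ℝ → ℂ} {f g : ℝ → ℂ}, TendstoW a b p s F f →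
      TendstoW a b p (s + 1) G g → TendstoW a b p s (fun k => F k * G k) (f * g))
    (hF : TendstoW a b p (s + 1) F f) (hG : TendstoW a b p (s + 1) G g) :
    TendstoW a b p (s + 1) (fun k => F k * G k) (f * g) := by
  have hm : ∀ k, MemW a b p (s + 1) (F k * G k) := fun k => ((hF.1 k).mul_self hab (hG.1 k)).1
  have hm0 := (hF.2.1.mul_self hab hG.2.1).1
  refine (tendstoW_succ_iff hab).2 ⟨hm, hm0,
    (hF.of_le hab (Nat.zero_le _)).mul_top hp (hG.uniform hab hp), ?_⟩
  have hF' := ((tendstoW_succ_iff hab).1 hF).2.2.2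
  have hG' := ((tendstoW_succ_iff hab).1 hG).2.2.2
  have key := (hmul hF' hG).add hab hp (hmul hG' hF)
  refine key.congr hab (fun k => (hm k).derivWithin hab) (hm0.derivWithin hab) (fun k => ?_) ?_
  · rw [mul_comm (_root_.derivWithin (G k) _)]
    exact ((hF.1 k).mul_self hab (hG.1 k)).2.symm
  · rw [mul_comm (_root_.derivWithin g _)]
    exact (hF.2.1.mul_self hab hG.2.1).2.symm

/-- Multiplication is continuous from `W^s_p × W^{s+1}_p` to `W^s_p`. -/
theorem TendstoW.mul (hab : a < b) (hp : 1 ≤ p) : ∀ {F G : ℕ → ℝ → ℂ} {f g : ℝ → ℂ},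
    TendstoW a b p s F f → TendstoW a b p (s + 1) G g →
      TendstoW a b p s (fun k => F k * G k) (f * g) := by
  induction s with
  | zero => exact fun hF hG => hF.mul_top hp (hG.uniform hab hp)
  | succ s ih =>
    exact fun hF hG => TendstoW.mul_self_of_mul hab hp ih hF (hG.of_le hab (Nat.le_succ _))

/-- Multiplication is continuous on `W^{s+1}_p`. -/
theorem TendstoW.mul_self (hab : a < b) (hp : 1 ≤ p) (hF : TendstoW a b p (s + 1) F f)
    (hG : TendstoW a b p (s + 1) G g) :
    TendstoW a b p (s + 1) (fun k => F k * G k) (f * g) :=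
  TendstoW.mul_self_of_mul hab hp (TendstoW.mul hab hp) hF hG

end Convergence

/-! ### Volterra operators -/

section Volterra

variable {a b : ℝ} {E : Type*} [NormedAddCommGroup E] [NormedSpace ℂ E]

theorem absolutelyContinuousOnInterval_pow {f : ℝ → ℝ} (hf : AbsolutelyContinuousOnInterval f a b)
    (n : ℕ) : AbsolutelyContinuousOnInterval (fun t => f t ^ (n + 1)) a b := by
  induction n with
  | zero => simpa using hf
  | succ n ih => simpa only [pow_succ _ (n + 1)] using ih.fun_mul hf

theorem integral_mul_primitive_pow {β : ℝ → ℝ} {t : ℝ} (hβ : IntervalIntegrable β volume a t)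
    (n : ℕ) : ∫ s in a..t, β s * ((∫ x in a..s, β x) ^ n / n.factorial) =
      (∫ x in a..t, β x) ^ (n + 1) / (n + 1).factorial := by
  have hac := (absolutelyContinuousOnInterval_pow
    (hβ.absolutelyContinuousOnInterval_intervalIntegral (c := a) left_mem_uIcc)
      n).integral_deriv_eq_sub
  simp only [intervalIntegral.integral_same, ne_eq, Nat.add_eq_zero_iff, one_ne_zero, and_false,
    not_false_eq_true, zero_pow, sub_zero] at hac
  rw [← hac, div_eq_mul_inv, ← intervalIntegral.integral_mul_const]
  refine intervalIntegral.integral_congr_ae ?_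
  filter_upwards [hβ.ae_hasDerivAt_integral] with s hs hmem
  have h := ((hs (uIoc_subset_uIcc hmem) a left_mem_uIcc).pow (n + 1)).deriv
  simp only [Nat.add_sub_cancel] at h
  change deriv (fun t => (∫ x in a..t, β x) ^ (n + 1)) s = _ at h
  rw [h, Nat.factorial_succ]
  have := Nat.factorial_ne_zero n
  push_cast
  field_simp

theorem intervalIntegrable_clm_apply (hab : a ≤ b) {𝒜 : ℝ → E →L[ℂ] E}
    (h𝒜 : IntervalIntegrable 𝒜 volume a b) (z : C(Icc a b, E)) :
    IntervalIntegrable (fun s => 𝒜 s (z (projIcc a b hab s))) volume a b := by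
  have hz : Continuous fun s => z (projIcc a b hab s) := z.continuous.comp continuous_projIcc
  refine (h𝒜.norm.mul_const ‖z‖).mono_fun ?_ (Eventually.of_forall fun s => ?_)
  · exact (ContinuousLinearMap.apply ℂ E).flip.aestronglyMeasurable_comp₂
      h𝒜.aestronglyMeasurable_restrict_uIoc hz.aestronglyMeasurable
  · dsimp only
    rw [norm_mul, norm_norm, norm_norm]
    exact (𝒜 s).le_of_opNorm_le_of_le le_rfl (z.norm_coe_le_norm _)

theorem norm_integral_clm_apply_le (hab : a ≤ b) {𝒜 : ℝ → E →L[ℂ] E}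
    (h𝒜 : IntervalIntegrable 𝒜 volume a b) (z : C(Icc a b, E)) (t : Icc a b) :
    ‖∫ s in a..t, 𝒜 s (z (projIcc a b hab s))‖ ≤ (∫ s in a..b, ‖𝒜 s‖) * ‖z‖ := by
  have ht := t.2
  refine (intervalIntegral.norm_integral_le_of_norm_le ht.1 (Eventually.of_forall fun s _ =>
    (𝒜 s).le_of_opNorm_le_of_le le_rfl (z.norm_coe_le_norm _))
    ((intervalIntegrable_of_mem_Icc h𝒜.norm (left_mem_Icc.2 hab) ht).mul_const _)).trans ?_
  rw [intervalIntegral.integral_mul_const]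
  gcongr
  exact intervalIntegral.integral_mono_interval le_rfl ht.1 ht.2
    (Eventually.of_forall fun s => norm_nonneg _) h𝒜.norm

/-- The Volterra operator `z ↦ (t ↦ ∫_a^t 𝒜(s) z(s) ds)` on `C([a,b]; E)` with an integrable
operator-valued coefficient `𝒜`. -/
noncomputable def volterra (hab : a ≤ b) (𝒜 : ℝ → E →L[ℂ] E)
    (h𝒜 : IntervalIntegrable 𝒜 volume a b) : C(Icc a b, E) →L[ℂ] C(Icc a b, E) :=
  LinearMap.mkContinuous
    { toFun := fun z => ⟨fun t => ∫ s in a..t, 𝒜 s (z (projIcc a b hab s)), by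
        have h := intervalIntegral.continuousOn_primitive_interval'
          (intervalIntegrable_clm_apply hab h𝒜 z) left_mem_uIcc
        rw [uIcc_of_le hab] at h
        exact h.domRestrict⟩
      map_add' := fun z w => by
        ext t
        simp only [ContinuousMap.add_apply, map_add, ContinuousMap.coe_mk]
        exact intervalIntegral.integral_add
          (intervalIntegrable_of_mem_Icc (intervalIntegrable_clm_apply hab h𝒜 z)
            (left_mem_Icc.2 hab) t.2)
          (intervalIntegrable_of_mem_Icc (intervalIntegrable_clm_apply hab h𝒜 w)
            (left_mem_Icc.2 hab) t.2)
      map_smul' := fun c z => by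
        ext t
        simp only [ContinuousMap.smul_apply, map_smul, ContinuousMap.coe_mk, RingHom.id_apply]
        exact intervalIntegral.integral_smul _ _ }
    (∫ s in a..b, ‖𝒜 s‖) fun z => by
      rw [ContinuousMap.norm_le _ (mul_nonneg (intervalIntegral.integral_nonneg hab
        fun s _ => norm_nonneg (𝒜 s)) (norm_nonneg z))]
      exact norm_integral_clm_apply_le hab h𝒜 z

variable (hab : a ≤ b) {𝒜 : ℝ → E →L[ℂ] E} (h𝒜 : IntervalIntegrable 𝒜 volume a b)

theorem volterra_apply (z : C(Icc a b, E)) (t : Icc a b) :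
    volterra hab 𝒜 h𝒜 z t = ∫ s in a..t, 𝒜 s (z (projIcc a b hab s)) := rfl

theorem norm_volterra_sub_le {ℬ : ℝ → E →L[ℂ] E} (hℬ : IntervalIntegrable ℬ volume a b) :
    ‖volterra hab 𝒜 h𝒜 - volterra hab ℬ hℬ‖ ≤ ∫ s in a..b, ‖𝒜 s - ℬ s‖ := by
  have h0 : 0 ≤ ∫ s in a..b, ‖𝒜 s - ℬ s‖ :=
    intervalIntegral.integral_nonneg hab fun s _ => norm_nonneg _
  refine ContinuousLinearMap.opNorm_le_bound _ h0 fun z => ?_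
  rw [ContinuousMap.norm_le _ (mul_nonneg h0 (norm_nonneg z))]
  intro t
  refine le_trans (le_of_eq ?_) (norm_integral_clm_apply_le hab (h𝒜.sub hℬ) z t)
  rw [sub_apply, ContinuousMap.sub_apply, volterra_apply, volterra_apply,
    ← intervalIntegral.integral_sub]
  · rfl
  · exact intervalIntegrable_of_mem_Icc (intervalIntegrable_clm_apply hab h𝒜 z)
      (left_mem_Icc.2 hab) t.2
  · exact intervalIntegrable_of_mem_Icc (intervalIntegrable_clm_apply hab hℬ z)
      (left_mem_Icc.2 hab) t.2

theorem norm_volterra_pow_apply_le (n : ℕ) (z : C(Icc a b, E)) (t : Icc a b) :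
    ‖(volterra hab 𝒜 h𝒜 ^ n) z t‖ ≤ (∫ s in a..t, ‖𝒜 s‖) ^ n / n.factorial * ‖z‖ := by
  induction n generalizing t with
  | zero => simpa using z.norm_coe_le_norm t
  | succ n ih =>
    have ht := t.2
    have hβ := intervalIntegrable_of_mem_Icc h𝒜.norm (left_mem_Icc.2 hab) ht
    rw [pow_succ', mul_apply_eq_comp, volterra_apply, ← integral_mul_primitive_pow hβ,
      ← intervalIntegral.integral_mul_const]
    refine intervalIntegral.norm_integral_le_of_norm_le ht.1 (Eventually.of_forall fun s hs => ?_)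
      ?_
    · have hs' : s ∈ Icc a b := ⟨hs.1.le, hs.2.trans ht.2⟩
      rw [projIcc_of_mem hab hs', mul_assoc]
      exact (𝒜 s).le_of_opNorm_le_of_le le_rfl (ih ⟨s, hs'⟩)
    · refine IntervalIntegrable.mul_const (hβ.mul_continuousOn ?_) _
      exact ((intervalIntegral.continuousOn_primitive_interval' hβ left_mem_uIcc).pow n).div_const _

/-- A Volterra operator is quasinilpotent, as `‖K^n‖ ≤ (∫ ‖𝒜‖)^n / n!`. -/
theorem isUnit_one_sub_volterra [CompleteSpace E] : IsUnit (1 - volterra hab 𝒜 h𝒜) := by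
  set K := volterra hab 𝒜 h𝒜
  set R := ∫ s in a..b, ‖𝒜 s‖
  have hR : 0 ≤ R := intervalIntegral.integral_nonneg hab fun s _ => norm_nonneg _
  obtain ⟨n, hn⟩ := ((FloorSemiring.tendsto_pow_div_factorial_atTop R).eventually_lt_const
    one_pos).exists
  have hK : ‖K ^ n‖ < 1 := by
    refine lt_of_le_of_lt (ContinuousLinearMap.opNorm_le_bound _ (by positivity) fun z => ?_) hn
    rw [ContinuousMap.norm_le _ (by positivity)]
    intro t
    refine (norm_volterra_pow_apply_le hab h𝒜 n z t).trans ?_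
    have h1 : ∫ s in a..t, ‖𝒜 s‖ ≤ R := intervalIntegral.integral_mono_interval le_rfl t.2.1 t.2.2
      (Eventually.of_forall fun s => norm_nonneg _) h𝒜.norm
    have h2 : 0 ≤ ∫ s in a..t, ‖𝒜 s‖ :=
      intervalIntegral.integral_nonneg t.2.1 fun s _ => norm_nonneg _
    gcongr
  have hu := isUnit_one_sub_of_norm_lt_one (R := C(Icc a b, E) →L[ℂ] C(Icc a b, E)) hK
  rw [← mul_neg_geom_sum K n] at hu
  exact ((Commute.isUnit_mul_iff ((mul_neg_geom_sum K n).trans (geom_sum_mul_neg K n).symm)).1 hu).1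

/-- The integral form of the Cauchy problem `z' = 𝒜 z`, `z(a) = c`. -/
def IsVolterraSolution (𝒜 : ℝ → E →L[ℂ] E) (c : E) (z : C(Icc a b, E)) : Prop :=
  ∀ t : Icc a b, z t = c + ∫ s in a..t, 𝒜 s (z (projIcc a b hab s))

theorem isVolterraSolution_iff (h𝒜 : IntervalIntegrable 𝒜 volume a b) {c : E}
    {z : C(Icc a b, E)} : IsVolterraSolution hab 𝒜 c z ↔
    (1 - volterra hab 𝒜 h𝒜) z = ContinuousMap.const _ c := by
  rw [ContinuousMap.ext_iff]
  simp only [IsVolterraSolution, sub_apply, one_apply_eq_self,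
    ContinuousMap.sub_apply, volterra_apply, ContinuousMap.const_apply, sub_eq_iff_eq_add]

theorem isVolterraSolution_iff_inverse (h𝒜 : IntervalIntegrable 𝒜 volume a b)
    [CompleteSpace E] {c : E} {z : C(Icc a b, E)} :
    IsVolterraSolution hab 𝒜 c z ↔
      z = Ring.inverse (1 - volterra hab 𝒜 h𝒜) (ContinuousMap.const _ c) := by
  have hu := isUnit_one_sub_volterra hab h𝒜
  rw [isVolterraSolution_iff hab h𝒜]
  constructor
  · intro h
    rw [← h, ← mul_apply_eq_comp, Ring.inverse_mul_cancel _ hu,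
      one_apply_eq_self]
  · rintro rfl
    rw [← mul_apply_eq_comp, Ring.mul_inverse_cancel _ hu,
      one_apply_eq_self]

theorem existsUnique_isVolterraSolution (h𝒜 : IntervalIntegrable 𝒜 volume a b)
    [CompleteSpace E] (c : E) :
    ∃! z : C(Icc a b, E), IsVolterraSolution hab 𝒜 c z := by
  simp only [isVolterraSolution_iff_inverse hab h𝒜, existsUnique_eq]

/-- The solution depends continuously on the coefficient in the `L_1` norm. -/
theorem IsVolterraSolution.tendsto [CompleteSpace E] {c : E} {z : C(Icc a b, E)}
    {𝒜k : ℕ → ℝ → E →L[ℂ] E} {zk : ℕ → C(Icc a b, E)}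
    (h𝒜 : IntervalIntegrable 𝒜 volume a b) (h𝒜k : ∀ k, IntervalIntegrable (𝒜k k) volume a b)
    (hlim : Tendsto (fun k => ∫ s in a..b, ‖𝒜k k s - 𝒜 s‖) atTop (𝓝 0))
    (hzk : ∀ k, IsVolterraSolution hab (𝒜k k) c (zk k)) (hz : IsVolterraSolution hab 𝒜 c z) :
    Tendsto zk atTop (𝓝 z) := by
  obtain ⟨u, hu⟩ := isUnit_one_sub_volterra hab h𝒜
  have hK : Tendsto (fun k => 1 - volterra hab (𝒜k k) (h𝒜k k)) atTop
      (𝓝 (1 - volterra hab 𝒜 h𝒜)) := by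
    refine tendsto_const_nhds.sub ((tendsto_iff_norm_sub_tendsto_zero
      (E := C(Icc a b, E) →L[ℂ] C(Icc a b, E))).2 ?_)
    exact squeeze_zero (fun k => norm_nonneg (volterra hab (𝒜k k) (h𝒜k k) - volterra hab 𝒜 h𝒜))
      (fun k => norm_volterra_sub_le hab (h𝒜k k) h𝒜) hlim
  rw [← hu] at hK
  have h := ((ContinuousLinearMap.apply ℂ C(Icc a b, E)
    (ContinuousMap.const (Icc a b) c)).continuous.tendsto _).comp
    ((NormedRing.inverse_continuousAt (R := C(Icc a b, E) →L[ℂ] C(Icc a b, E)) u).tendsto.comp hK)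
  rw [(isVolterraSolution_iff_inverse hab h𝒜).1 hz, ← hu]
  exact h.congr fun k => ((isVolterraSolution_iff_inverse hab (h𝒜k k)).1 (hzk k)).symm

end Volterra

/-! ### The companion system -/

section Companion

variable {a b : ℝ} {p : ℝ≥0∞} {n m r : ℕ}

/-- The matrix unit of the companion system that carries the coefficient with the index
`x = (j, q, q')`: it maps `z` to the vector whose only nonzero entry is `z_{j,q'}`, in the
`q`-th place of the last block. -/
noncomputable def companionUnit (x : Fin r × Fin m × Fin m) :
    (Fin r → Fin m → ℂ) →L[ℂ] (Fin r → Fin m → ℂ) :=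
  ContinuousLinearMap.pi fun i => ContinuousLinearMap.pi fun q =>
    if (i : ℕ) + 1 < r then 0 else if q = x.2.1 then
      (ContinuousLinearMap.proj (φ := fun _ : Fin m => ℂ) x.2.2).comp
        (ContinuousLinearMap.proj (φ := fun _ : Fin r => Fin m → ℂ) x.1) else 0

/-- The block shift `z ↦ (z_1, …, z_{r-1}, 0)`. -/
noncomputable def companionShift (r m : ℕ) : (Fin r → Fin m → ℂ) →L[ℂ] (Fin r → Fin m → ℂ) :=
  ContinuousLinearMap.pi fun i =>
    if h : (i : ℕ) + 1 < r then
      ContinuousLinearMap.proj (φ := fun _ : Fin r => Fin m → ℂ) ⟨i + 1, h⟩ else 0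

/-- The coefficient of the first-order system for `z = (y, y', …, y^{(r-1)})` that is equivalent to
`y^{(r)} + ∑_j α_j y^{(j)} = 0`. -/
noncomputable def companion (α : Fin r → Fin m → Fin m → ℝ → ℂ) (s : ℝ) :
    (Fin r → Fin m → ℂ) →L[ℂ] (Fin r → Fin m → ℂ) :=
  companionShift r m - ∑ x : Fin r × Fin m × Fin m, α x.1 x.2.1 x.2.2 s • companionUnit x

theorem companion_apply_of_lt (α : Fin r → Fin m → Fin m → ℝ → ℂ) (s : ℝ)
    (z : Fin r → Fin m → ℂ) {i : Fin r} (hi : (i : ℕ) + 1 < r) (q : Fin m) :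
    companion α s z i q = z ⟨i + 1, hi⟩ q := by
  simp [companion, companionShift, companionUnit, hi]

theorem companion_apply_last (α : Fin r → Fin m → Fin m → ℝ → ℂ) (s : ℝ)
    (z : Fin r → Fin m → ℂ) {i : Fin r} (hi : (i : ℕ) + 1 = r) (q : Fin m) :
    companion α s z i q = -∑ j, ∑ q', α j q q' s * z j q' := by
  have hi' : ¬ (i : ℕ) + 1 < r := by omega
  simp only [companion, companionShift, companionUnit, sub_apply, ContinuousLinearMap.pi_apply,
    Pi.sub_apply, hi', dif_neg, if_false, not_false_eq_true, zero_apply, Pi.zero_apply, zero_sub,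
    sum_apply, smul_apply, Finset.sum_apply, Pi.smul_apply]
  rw [Fintype.sum_prod_type]
  congr 1
  refine Finset.sum_congr rfl fun j _ => ?_
  rw [Fintype.sum_prod_type, Finset.sum_eq_single q]
  · simp
  · intro q'' _ hq
    simp [hq.symm]
  · simp

theorem intervalIntegrable_companion (hab : a < b) (hp : 1 ≤ p)
    {α : Fin r → Fin m → Fin m → ℝ → ℂ} (hα : ∀ j q q', MemW a b p n (α j q q')) :
    IntervalIntegrable (companion α) volume a b := by
  refine intervalIntegrable_const.sub ?_
  have := IntervalIntegrable.sum (μ := volume) (a := a) (b := b) Finset.univ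
    (f := fun (x : Fin r × Fin m × Fin m) (s : ℝ) => α x.1 x.2.1 x.2.2 s • companionUnit x)
    fun x _ => by
      have h := intervalIntegrable_of_memLp hab hp
        ((hα x.1 x.2.1 x.2.2).of_le hab (Nat.zero_le n))
      exact ⟨h.1.smul_const _, h.2.smul_const _⟩
  rwa [Finset.sum_fn] at this

theorem tendsto_integral_companion_sub (hab : a < b) (hp : 1 ≤ p)
    {α : Fin r → Fin m → Fin m → ℝ → ℂ} {αk : ℕ → Fin r → Fin m → Fin m → ℝ → ℂ}
    (hα : ∀ j q q', TendstoW a b p n (fun k => αk k j q q') (α j q q')) :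
    Tendsto (fun k => ∫ s in a..b, ‖companion (αk k) s - companion α s‖) atTop (𝓝 0) := by
  have hi : ∀ k (x : Fin r × Fin m × Fin m), IntervalIntegrable
      (fun s => ‖(αk k x.1 x.2.1 x.2.2 - α x.1 x.2.1 x.2.2) s‖ * ‖companionUnit x‖)
      volume a b := fun k x =>
    (intervalIntegrable_of_memLp hab hp (((hα x.1 x.2.1 x.2.2).sub_limit hab hp).of_le hab
      (Nat.zero_le n) |>.1 k)).norm.mul_const _
  have hlim : Tendsto (fun k => ∑ x : Fin r × Fin m × Fin m,
      (∫ s in a..b, ‖(αk k x.1 x.2.1 x.2.2 - α x.1 x.2.1 x.2.2) s‖) * ‖companionUnit x‖)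
      atTop (𝓝 0) := by
    rw [show (0 : ℝ) = ∑ x : Fin r × Fin m × Fin m, 0 * ‖companionUnit x‖ by simp]
    refine tendsto_finsetSum _ fun x _ => Tendsto.mul_const _ ?_
    have h1 := tendstoW_zero_iff.1 ((((hα x.1 x.2.1 x.2.2).of_le hab
      (Nat.zero_le n))).mono_exponent hp)
    have h2 := (ENNReal.tendsto_toReal ENNReal.zero_ne_top).comp h1.2.2
    refine h2.congr fun k => ?_
    rw [Function.comp_apply, eLpNorm_one_eq_lintegral_enorm,
      ← integral_norm_eq_lintegral_enorm ((h1.1 k).sub h1.2.1).1,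
      intervalIntegral.integral_of_le hab.le, integral_Icc_eq_integral_Ioc]
  refine squeeze_zero (fun k => intervalIntegral.integral_nonneg hab.le fun s _ => norm_nonneg _)
    (fun k => ?_) hlim
  have hα0 := fun j q q' => (hα j q q').2.1
  have hαk := fun j q q' => (hα j q q').1 k
  simp only [← intervalIntegral.integral_mul_const]
  rw [← intervalIntegral.integral_finsetSum fun x _ => hi k x]
  refine intervalIntegral.integral_mono_on hab.le
    ((intervalIntegrable_companion hab hp hαk).sub (intervalIntegrable_companion hab hp hα0)).norm
    ?_ fun s _ => ?_
  · have := IntervalIntegrable.sum (μ := volume) (a := a) (b := b) Finset.univ fun x _ => hi k x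
    rwa [Finset.sum_fn] at this
  · have e : companion (αk k) s - companion α s = -∑ x : Fin r × Fin m × Fin m,
        (αk k x.1 x.2.1 x.2.2 - α x.1 x.2.1 x.2.2) s • companionUnit x := by
      have h : ∀ x : Fin r × Fin m × Fin m, (αk k x.1 x.2.1 x.2.2 - α x.1 x.2.1 x.2.2) s •
          companionUnit x = αk k x.1 x.2.1 x.2.2 s • companionUnit x -
            α x.1 x.2.1 x.2.2 s • companionUnit x := fun x => by
        ext z i q; simp [sub_mul]
      rw [Finset.sum_congr rfl fun x _ => h x, Finset.sum_sub_distrib, companion, companion,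
        sub_sub_sub_cancel_left, neg_sub]
    rw [e, norm_neg]
    refine (norm_sum_le _ _).trans (Finset.sum_le_sum fun x _ => ?_)
    rw [norm_smul]

variable (hab : a < b)

/-- The component functions on the real line of a continuous vector function on `[a,b]`. -/
noncomputable def component (z : C(Icc a b, Fin r → Fin m → ℂ)) (j : Fin r) (q : Fin m)
    (t : ℝ) : ℂ :=
  z (projIcc a b hab.le t) j q

theorem continuous_component (z : C(Icc a b, Fin r → Fin m → ℂ)) (j : Fin r) (q : Fin m) :
    Continuous (component hab z j q) :=
  (continuous_apply q).comp ((continuous_apply j).comp (z.continuous.comp continuous_projIcc))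

/-- The right-hand side of the companion system in its last block. -/
noncomputable def lastRhs (α : Fin r → Fin m → Fin m → ℝ → ℂ)
    (z : C(Icc a b, Fin r → Fin m → ℂ)) (q : Fin m) (t : ℝ) : ℂ :=
  -∑ j, ∑ q', α j q q' t * component hab z j q' t

theorem isVolterraSolution_companion_iff (hp : 1 ≤ p)
    {α : Fin r → Fin m → Fin m → ℝ → ℂ} (hα : ∀ j q q', MemW a b p n (α j q q'))
    {c : Fin r → Fin m → ℂ} {z : C(Icc a b, Fin r → Fin m → ℂ)} :
    IsVolterraSolution hab.le (companion α) c z ↔ ∀ j q, EqOn (component hab z j q)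
      (primitive a (c j q) (if h : (j : ℕ) + 1 < r then component hab z ⟨j + 1, h⟩ q
        else lastRhs hab α z q)) (Icc a b) := by
  have hint := intervalIntegrable_clm_apply hab.le (intervalIntegrable_companion hab hp hα) z
  have key : ∀ t ∈ Icc a b, ∀ j q,
      (∫ s in a..t, companion α s (z (projIcc a b hab.le s))) j q =
      ∫ s in a..t, (if h : (j : ℕ) + 1 < r then component hab z ⟨j + 1, h⟩ q
        else lastRhs hab α z q) s := by
    intro t ht j q
    have h1 := ((ContinuousLinearMap.proj (R := ℂ) (φ := fun _ : Fin m => ℂ) q).comp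
      (ContinuousLinearMap.proj (φ := fun _ : Fin r => Fin m → ℂ) j)).intervalIntegral_comp_comm
        (intervalIntegrable_of_mem_Icc hint (left_mem_Icc.2 hab.le) ht)
    simp only [ContinuousLinearMap.coe_comp, Function.comp_apply,
      ContinuousLinearMap.proj_apply] at h1
    rw [← h1]
    congr 1
    ext1 s
    split_ifs with hj
    · rw [companion_apply_of_lt _ _ _ hj]; rfl
    · rw [companion_apply_last _ _ _ (by omega)]; rfl
  constructor
  · intro h j q t ht
    have := congrFun (congrFun (h ⟨t, ht⟩) j) q
    rw [Pi.add_apply, Pi.add_apply, key t ht] at this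
    rw [component, projIcc_of_mem hab.le ht, this, primitive]
  · intro h t
    ext j q
    have := h j q t.2
    rw [component, projIcc_val hab.le] at this
    rw [this, primitive, Pi.add_apply, Pi.add_apply, key t t.2]

theorem tendstoW_lastRhs (hp : 1 ≤ p) {s : ℕ} {α : Fin r → Fin m → Fin m → ℝ → ℂ}
    {αk : ℕ → Fin r → Fin m → Fin m → ℝ → ℂ} {z : C(Icc a b, Fin r → Fin m → ℂ)}
    {zk : ℕ → C(Icc a b, Fin r → Fin m → ℂ)}
    (h : ∀ j q q', TendstoW a b p s (fun k => αk k j q q' * component hab (zk k) j q')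
      (α j q q' * component hab z j q')) (q : Fin m) :
    TendstoW a b p s (fun k => lastRhs hab (αk k) (zk k) q) (lastRhs hab α z q) := by
  have := (TendstoW.sum hab hp Finset.univ fun j _ =>
    TendstoW.sum hab hp Finset.univ fun q' _ => h j q q').smul (-1 : ℂ)
  refine this.congr_eqOn hab (fun k t _ => ?_) fun t _ => ?_ <;> simp [lastRhs]

/-- Continuous dependence of the solution of the companion system on the coefficients. The uniform
convergence of the solutions is bootstrapped: if the right-hand sides of the last block converge in
`W^s_p`, then the blocks converge in `W^{s+1}_p`, hence so do the right-hand sides if `s < n`. -/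
theorem tendstoW_component_of_isVolterraSolution (hp : 1 ≤ p) {α : Fin r → Fin m → Fin m → ℝ → ℂ}
    {αk : ℕ → Fin r → Fin m → Fin m → ℝ → ℂ}
    (hα : ∀ j q q', TendstoW a b p n (fun k => αk k j q q') (α j q q'))
    {c : Fin r → Fin m → ℂ} {z : C(Icc a b, Fin r → Fin m → ℂ)}
    {zk : ℕ → C(Icc a b, Fin r → Fin m → ℂ)}
    (hz : IsVolterraSolution hab.le (companion α) c z)
    (hzk : ∀ k, IsVolterraSolution hab.le (companion (αk k)) c (zk k)) (j : Fin r) (q : Fin m) :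
    TendstoW a b p (n + (r - j)) (fun k => component hab (zk k) j q) (component hab z j q) := by
  have hα0 := fun j q q' => (hα j q q').2.1
  have hαk := fun k j q q' => (hα j q q').1 k
  have hlim := IsVolterraSolution.tendsto hab.le (intervalIntegrable_companion hab hp hα0)
    (fun k => intervalIntegrable_companion hab hp (hαk k))
    (tendsto_integral_companion_sub hab hp hα) hzk hz
  have h0 : ∀ j q, TendstoW a b ∞ 0 (fun k => component hab (zk k) j q) (component hab z j q) := by
    intro j q
    refine tendstoW_zero_iff.2 ⟨fun k => memLp_top_of_continuousOn
      (continuous_component hab _ j q).continuousOn, memLp_top_of_continuousOn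
      (continuous_component hab _ j q).continuousOn, ?_⟩
    have h1 := (tendsto_iff_norm_sub_tendsto_zero.1 hlim)
    have h2 := (ENNReal.tendsto_ofReal h1)
    rw [ENNReal.ofReal_zero] at h2
    refine tendsto_of_tendsto_of_tendsto_of_le_of_le tendsto_const_nhds h2 (fun _ => zero_le)
      fun k => eLpNorm_top_le_of_forall fun t _ => ?_
    rw [← ofReal_norm]
    refine ENNReal.ofReal_le_ofReal ?_
    refine le_trans ?_ ((zk k - z).norm_coe_le_norm (projIcc a b hab.le t))
    exact (norm_le_pi_norm ((zk k - z) (projIcc a b hab.le t) j) q).trans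
      (norm_le_pi_norm ((zk k - z) (projIcc a b hab.le t)) j)
  rw [isVolterraSolution_companion_iff hab hp hα0] at hz
  replace hzk := fun k => (isVolterraSolution_companion_iff hab hp (hαk k)).1 (hzk k)
  -- regularity gained in the last block descends to the first one
  have hdown : ∀ s, (∀ q, TendstoW a b p s (fun k => lastRhs hab (αk k) (zk k) q)
      (lastRhs hab α z q)) → ∀ (d : ℕ) (j : Fin r), j + 1 + d = r → ∀ q,
        TendstoW a b p (s + 1 + d) (fun k => component hab (zk k) j q) (component hab z j q) := by
    intro s hs d
    induction d with
    | zero =>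
      intro j hj q
      have hj' : ¬ (j : ℕ) + 1 < r := by omega
      refine ((hs q).primitive hab hp (tendsto_const_nhds (x := c j q))).congr_eqOn hab
        (fun k t ht => ?_) fun t ht => ?_
      · simpa [hj'] using (hzk k j q ht).symm
      · simpa [hj'] using (hz j q ht).symm
    | succ d ih =>
      intro j hj q
      have hj' : (j : ℕ) + 1 < r := by omega
      refine ((ih ⟨j + 1, hj'⟩ (by simp only; omega) q).primitive hab hp
        (tendsto_const_nhds (x := c j q))).congr_eqOn hab (fun k t ht => ?_) fun t ht => ?_
      · simpa [hj'] using (hzk k j q ht).symm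
      · simpa [hj'] using (hz j q ht).symm
  -- products with the coefficients inherit this regularity, up to the order `n`
  have hrhs : ∀ s ≤ n, ∀ q, TendstoW a b p s (fun k => lastRhs hab (αk k) (zk k) q)
      (lastRhs hab α z q) := by
    intro s
    induction s with
    | zero =>
      exact fun _ => tendstoW_lastRhs hab hp fun j q q' =>
        ((hα j q q').of_le hab (Nat.zero_le n)).mul_top hp (h0 j q')
    | succ s ih =>
      intro hs
      refine tendstoW_lastRhs hab hp fun j q q' => ?_
      refine ((hα j q q').of_le hab hs).mul_self hab hp ?_
      have hj := j.2
      exact (hdown s (ih (by omega)) (r - (j + 1)) j (by omega) q').of_le hab (by omega)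
  have hj := j.2
  exact (hdown n (hrhs n le_rfl) (r - (j + 1)) j (by omega) q).of_le hab (by omega)

end Companion

/-! ### The initial value problem -/

section InitialValueProblem

variable {a b : ℝ} {p : ℝ≥0∞} {n m r : ℕ}

/-- The vector function `y` of class `W^{n+r}_p` solves `y^{(r)} + ∑_j α_j y^{(j)} = 0` almost
everywhere on `[a,b]`, with the initial values `y^{(j)}(a) = c_j` for `0 ≤ j < r`. -/
def IsIVPSolution (a b : ℝ) (p : ℝ≥0∞) (n : ℕ) (α : Fin r → Fin m → Fin m → ℝ → ℂ)
    (c : Fin r → Fin m → ℂ) (y : Fin m → ℝ → ℂ) : Prop :=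
  (∀ q, MemW a b p (n + r) (y q)) ∧
  (∀ i, (fun t => iteratedDerivWithin r (y i) (Icc a b) t +
    ∑ j : Fin r, ∑ q : Fin m, α j i q t * iteratedDerivWithin j (y q) (Icc a b) t)
      =ᵐ[volume.restrict (Icc a b)] 0) ∧
  ∀ (j : Fin r) q, iteratedDerivWithin j (y q) (Icc a b) a = c j q

variable {α : Fin r → Fin m → Fin m → ℝ → ℂ} {c : Fin r → Fin m → ℂ} {y : Fin m → ℝ → ℂ}

theorem IsIVPSolution.congr {w : Fin m → ℝ → ℂ} (hab : a < b)
    (hy : IsIVPSolution a b p n α c y)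
    (h : ∀ q, EqOn (y q) (w q) (Icc a b)) : IsIVPSolution a b p n α c w := by
  have hD : ∀ j q, EqOn (iteratedDerivWithin j (y q) (Icc a b))
      (iteratedDerivWithin j (w q) (Icc a b)) (Icc a b) :=
    fun j q => iteratedDerivWithin_congr (h q)
  refine ⟨fun q => (hy.1 q).congr hab (h q), fun i => ?_, fun j q => ?_⟩
  · filter_upwards [hy.2.1 i, ae_restrict_mem measurableSet_Icc] with t ht hmem
    simpa only [hD _ _ hmem] using ht
  · rw [← hy.2.2 j q, hD j q (left_mem_Icc.2 hab.le)]

/-- The vector `(y, y', …, y^{(r-1)})` of a solution solves the companion system. -/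
theorem IsIVPSolution.exists_isVolterraSolution (hab : a < b) (hp : 1 ≤ p)
    (hα : ∀ j q q', MemW a b p n (α j q q')) (hy : IsIVPSolution a b p n α c y) :
    ∃ z, IsVolterraSolution hab.le (companion α) c z ∧
      ∀ j q, EqOn (component hab z j q) (iteratedDerivWithin j (y q) (Icc a b)) (Icc a b) := by
  have hD : ∀ (j : Fin r) q, MemW a b p (n + (r - (j + 1)) + 1)
      (iteratedDerivWithin j (y q) (Icc a b)) := fun j q =>
    MemW.iteratedDerivWithin hab j ((hy.1 q).of_le hab (by omega))
  let z : C(Icc a b, Fin r → Fin m → ℂ) :=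
    ⟨fun t j q => iteratedDerivWithin j (y q) (Icc a b) t, continuous_pi fun j =>
      continuous_pi fun q => (hD j q).continuousOn.domRestrict⟩
  have hz : ∀ j q, EqOn (component hab z j q) (iteratedDerivWithin j (y q) (Icc a b))
      (Icc a b) := by
    intro j q t ht
    simp only [component, projIcc_of_mem hab.le ht, z, ContinuousMap.coe_mk]
  refine ⟨z, ?_, hz⟩
  rw [isVolterraSolution_companion_iff hab hp hα]
  intro j q t ht
  rw [hz j q ht, (hD j q).eq_primitive hab hp ht, hy.2.2 j q, primitive, primitive]
  congr 1
  refine intervalIntegral.integral_congr_ae_restrict ?_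
  refine ae_restrict_of_ae_restrict_of_subset (t := Icc a b)
    (uIoc_subset_uIcc.trans (uIcc_subset_Icc (left_mem_Icc.2 hab.le) ht)) ?_
  rw [← iteratedDerivWithin_succ]
  split_ifs with hj
  · exact (ae_of_eqOn (hz ⟨j + 1, hj⟩ q)).symm
  · have hjr : (j : ℕ) + 1 = r := by omega
    rw [hjr]
    filter_upwards [hy.2.1 q, ae_restrict_mem measurableSet_Icc] with s hs hmem
    have e : ∀ j q', component hab z j q' s = iteratedDerivWithin j (y q') (Icc a b) s :=
      fun j q' => hz j q' hmem
    simp only [lastRhs, e]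
    exact eq_neg_of_add_eq_zero_left hs

/-- The blocks of a solution of the companion system are the derivatives of the first block. -/
theorem IsVolterraSolution.iteratedDerivWithin_component (hab : a < b) (hp : 1 ≤ p) (hr : 0 < r)
    (hα : ∀ j q q', MemW a b p n (α j q q')) {z : C(Icc a b, Fin r → Fin m → ℂ)}
    (hz : IsVolterraSolution hab.le (companion α) c z) (j : ℕ) (hj : j < r) (q : Fin m) :
    EqOn (iteratedDerivWithin j (component hab z ⟨0, hr⟩ q) (Icc a b)) (component hab z ⟨j, hj⟩ q)
      (Icc a b) := by
  rw [isVolterraSolution_companion_iff hab hp hα] at hz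
  induction j with
  | zero => simp [EqOn]
  | succ j ih =>
    intro t ht
    have h1 := hz ⟨j, by omega⟩ q
    simp only [hj, dif_pos] at h1
    rw [iteratedDerivWithin_succ, derivWithin_congr ((ih (by omega)).trans h1)
      ((ih (by omega)).trans h1 ht)]
    exact (hasDerivWithinAt_primitive (continuous_component hab _ _ _).continuousOn _
      ht).derivWithin (uniqueDiffOn_Icc hab t ht)

theorem IsVolterraSolution.iteratedDerivWithin_component_order (hab : a < b) (hp : 1 ≤ p)
    (hr : 0 < r)
    (hα : ∀ j q q', MemW a b p n (α j q q')) {z : C(Icc a b, Fin r → Fin m → ℂ)}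
    (hz : IsVolterraSolution hab.le (companion α) c z) (q : Fin m) :
    iteratedDerivWithin r (component hab z ⟨0, hr⟩ q) (Icc a b) =ᵐ[volume.restrict (Icc a b)]
      lastRhs hab α z q := by
  have hD := hz.iteratedDerivWithin_component hab hp hr hα (r - 1) (by omega) q
  have h1 := (isVolterraSolution_companion_iff hab hp hα).1 hz ⟨r - 1, by omega⟩ q
  rw [dif_neg (by simp only; omega)] at h1
  have hint : IntervalIntegrable (lastRhs hab α z q) volume a b :=
    intervalIntegrable_of_memLp hab hp (tendstoW_lastRhs hab hp (fun j q q' =>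
      ((tendstoW_const (hα j q q')).of_le hab (Nat.zero_le n)).mul_top hp
        (tendstoW_const (s := 0) (memLp_top_of_continuousOn
          (continuous_component hab z j q').continuousOn))) q).2.1
  filter_upwards [derivWithin_primitive_ae hab hint (c ⟨r - 1, by omega⟩ q),
    ae_restrict_mem measurableSet_Icc] with t ht hmem
  have h2 := hD.trans h1
  rw [show iteratedDerivWithin r (component hab z ⟨0, hr⟩ q) (Icc a b) t =
    iteratedDerivWithin (r - 1 + 1) (component hab z ⟨0, hr⟩ q) (Icc a b) t by
      rw [Nat.sub_add_cancel hr], iteratedDerivWithin_succ, derivWithin_congr h2 (h2 hmem), ht]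

/-- The first block of the solution of the companion system solves the initial value problem. Its
regularity is the case of constant sequences of `tendstoW_component_of_isVolterraSolution`. -/
theorem exists_isIVPSolution (hab : a < b) (hp : 1 ≤ p) (hr : 0 < r)
    (hα : ∀ j q q', MemW a b p n (α j q q')) (c : Fin r → Fin m → ℂ) :
    ∃ y, IsIVPSolution a b p n α c y := by
  obtain ⟨z, hz, -⟩ := existsUnique_isVolterraSolution hab.le
    (intervalIntegrable_companion hab hp hα) c
  have hD := fun (j : Fin r) q => hz.iteratedDerivWithin_component hab hp hr hα j j.2 q
  have hm : ∀ q, MemW a b p (n + r) (component hab z ⟨0, hr⟩ q) := fun q => by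
    have h := tendstoW_component_of_isVolterraSolution hab hp (αk := fun _ => α)
      (fun j q q' => tendstoW_const (hα j q q')) hz (fun _ => hz) ⟨0, hr⟩ q
    exact h.2.1
  refine ⟨fun q => component hab z ⟨0, hr⟩ q, hm, fun i => ?_, fun j q => ?_⟩
  · filter_upwards [hz.iteratedDerivWithin_component_order hab hp hr hα i,
      ae_restrict_mem measurableSet_Icc] with t ht hmem
    rw [ht, lastRhs, Pi.zero_apply, neg_add_eq_zero]
    exact Finset.sum_congr rfl fun j _ => Finset.sum_congr rfl fun q _ => by rw [hD j q hmem]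
  · have ha := left_mem_Icc.2 hab.le
    rw [hD j q ha, (isVolterraSolution_companion_iff hab hp hα).1 hz j q ha, primitive_left]

theorem IsIVPSolution.eqOn (hab : a < b) (hp : 1 ≤ p) (hr : 0 < r)
    (hα : ∀ j q q', MemW a b p n (α j q q')) (hy : IsIVPSolution a b p n α c y)
    {w : Fin m → ℝ → ℂ} (hw : IsIVPSolution a b p n α c w) (q : Fin m) :
    EqOn (y q) (w q) (Icc a b) := by
  obtain ⟨z, hz, hzy⟩ := hy.exists_isVolterraSolution hab hp hα
  obtain ⟨z', hz', hzw⟩ := hw.exists_isVolterraSolution hab hp hα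
  obtain rfl := (existsUnique_isVolterraSolution hab.le
    (intervalIntegrable_companion hab hp hα) c).unique hz hz'
  intro t ht
  simpa using (hzy ⟨0, hr⟩ q ht).symm.trans (hzw ⟨0, hr⟩ q ht)

/-- Continuous dependence of the solution of the initial value problem on the coefficients. -/
theorem IsIVPSolution.tendstoW (hab : a < b) (hp : 1 ≤ p) (hr : 0 < r)
    {αk : ℕ → Fin r → Fin m → Fin m → ℝ → ℂ} {yk : ℕ → Fin m → ℝ → ℂ}
    (hα : ∀ j q q', TendstoW a b p n (fun k => αk k j q q') (α j q q'))
    (hy : IsIVPSolution a b p n α c y) (hyk : ∀ k, IsIVPSolution a b p n (αk k) c (yk k))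
    (q : Fin m) : TendstoW a b p (n + r) (fun k => yk k q) (y q) := by
  obtain ⟨z, hz, hzy⟩ := hy.exists_isVolterraSolution hab hp fun j q q' => (hα j q q').2.1
  choose zk hzk hzyk using fun k =>
    (hyk k).exists_isVolterraSolution hab hp fun j q q' => (hα j q q').1 k
  refine (tendstoW_component_of_isVolterraSolution hab hp hα hz hzk ⟨0, hr⟩ q).congr_eqOn hab
    (fun k t ht => ?_) fun t ht => ?_
  · simpa using hzyk k ⟨0, hr⟩ q ht
  · simpa using hzy ⟨0, hr⟩ q ht

end InitialValueProblem

/-! ### Test functions -/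

section TestFunctions

variable {a b : ℝ} {p : ℝ≥0∞}

/-- The functions `(t - a)^d / d!`, obtained by repeated integration. -/
noncomputable def taylorMonomial (a : ℝ) : ℕ → ℝ → ℂ
  | 0 => 1
  | d + 1 => primitive a 0 (taylorMonomial a d)

theorem memW_taylorMonomial (hab : a < b) (hp : 1 ≤ p) (d : ℕ) : ∀ s,
    MemW a b p s (taylorMonomial a d) := by
  induction d with
  | zero =>
    intro s
    refine (((memW_zero hab s).primitive hab hp 1).congr hab fun t _ => ?_).of_succ hab
    simp [primitive, taylorMonomial]
  | succ d ih => exact fun s => ((ih s).primitive hab hp 0).of_succ hab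

theorem derivWithin_taylorMonomial_succ (hab : a < b) (d : ℕ) :
    EqOn (derivWithin (taylorMonomial a (d + 1)) (Icc a b)) (taylorMonomial a d) (Icc a b) :=
  fun t ht => (hasDerivWithinAt_primitive
    (memW_taylorMonomial hab (le_refl 1) d 1).continuousOn 0 ht).derivWithin
      (uniqueDiffOn_Icc hab t ht)

theorem iteratedDerivWithin_taylorMonomial_self (hab : a < b) (d : ℕ) :
    EqOn (iteratedDerivWithin d (taylorMonomial a d) (Icc a b)) 1 (Icc a b) := by
  induction d with
  | zero => simp [EqOn, taylorMonomial]
  | succ d ih =>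
    rw [iteratedDerivWithin_succ']
    exact (iteratedDerivWithin_congr (derivWithin_taylorMonomial_succ hab d)).trans ih

theorem iteratedDerivWithin_taylorMonomial_of_lt (hab : a < b) {d j : ℕ} (hj : d < j) :
    EqOn (iteratedDerivWithin j (taylorMonomial a d) (Icc a b)) 0 (Icc a b) := by
  induction j generalizing d with
  | zero => omega
  | succ j ih =>
    rw [iteratedDerivWithin_succ']
    cases d with
    | zero =>
      intro t _
      have e : derivWithin (taylorMonomial a 0) (Icc a b) = 0 := by
        ext t; simp [taylorMonomial, Pi.one_def]
      rw [e]
      simp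
    | succ d =>
      exact (iteratedDerivWithin_congr (derivWithin_taylorMonomial_succ hab d)).trans
        (ih (by omega))

end TestFunctions

/-! ### Closedness of the Sobolev spaces -/

section Closed

variable {a b : ℝ} {p : ℝ≥0∞} {F : ℕ → ℝ → ℂ} {f g : ℝ → ℂ} {s : ℕ}

theorem TendstoW.unique_ae (hp : 1 ≤ p) (hf : TendstoW a b p 0 F f) (hg : TendstoW a b p 0 F g) :
    f =ᵐ[volume.restrict (Icc a b)] g := by
  rw [tendstoW_zero_iff] at hf hg
  have h := hf.2.2.add hg.2.2
  rw [add_zero] at h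
  have hle : eLpNorm (f - g) p (volume.restrict (Icc a b)) ≤ 0 := by
    refine ge_of_tendsto' h fun k => ?_
    have e : f - g = (f - F k) + (F k - g) := by ring
    rw [e, eLpNorm_sub_comm (F k) f]
    exact eLpNorm_add_le (hf.2.1.sub (hf.1 k)).1 ((hf.1 k).sub hg.2.1).1 hp
  have h0 := (eLpNorm_eq_zero_iff (hf.2.1.sub hg.2.1).1 (one_pos.trans_le hp).ne').1
    (le_antisymm hle zero_le)
  filter_upwards [h0] with t ht
  simpa [sub_eq_zero] using ht

/-- The space `W^s_p` is closed: if the derivatives of `F k` up to the order `s` converge in `L_p`,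
then the limits are the derivatives of a function of class `W^s_p`. The constant of integration
is found by integrating `F k (a) = F k - ∫_a F k'` over `[a,b]`. -/
theorem exists_memW_of_tendsto (hab : a < b) (hp : 1 ≤ p) : ∀ {F : ℕ → ℝ → ℂ} {g : ℕ → ℝ → ℂ},
    (∀ k, MemW a b p s (F k)) → (∀ i ≤ s, MemLp (g i) p (volume.restrict (Icc a b))) →
    (∀ i ≤ s, Tendsto (fun k => eLpNorm (iteratedDerivWithin i (F k) (Icc a b) - g i) p
      (volume.restrict (Icc a b))) atTop (𝓝 0)) →
    ∃ f, MemW a b p s f ∧ ∀ i ≤ s,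
      iteratedDerivWithin i f (Icc a b) =ᵐ[volume.restrict (Icc a b)] g i := by
  induction s with
  | zero =>
    intro F g _ hg _
    refine ⟨g 0, hg 0 le_rfl, fun i hi => ?_⟩
    obtain rfl : i = 0 := by omega
    simp
  | succ s ih =>
    intro F g hF hg hlim
    obtain ⟨h, hh, hhg⟩ := ih (F := fun k => derivWithin (F k) (Icc a b))
      (g := fun i => g (i + 1)) (fun k => (hF k).derivWithin hab)
      (fun i hi => hg (i + 1) (by omega))
      (fun i hi => by simpa only [iteratedDerivWithin_succ'] using hlim (i + 1) (by omega))
    have hder : TendstoW a b p s (fun k => derivWithin (F k) (Icc a b)) h := by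
      refine ⟨fun k => (hF k).derivWithin hab, hh, fun i hi => ?_⟩
      refine (hlim (i + 1) (by omega)).congr fun k => eLpNorm_congr_ae ?_
      rw [iteratedDerivWithin_succ']
      exact EventuallyEq.rfl.sub (hhg i hi).symm
    have h0 : TendstoW a b p 0 F (g 0) := tendstoW_zero_iff.2
      ⟨fun k => (hF k).of_le hab (Nat.zero_le _), hg 0 (Nat.zero_le _),
        by simpa using hlim 0 (Nat.zero_le _)⟩
    have h1 := (h0.add hab hp (((hder.primitive hab hp
      (tendsto_const_nhds (x := (0 : ℂ)))).of_le hab (Nat.zero_le _)).smul (-1))).mono_exponent hp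
    obtain ⟨h2, h3, h4⟩ := tendstoW_zero_iff.1 h1
    have hint := tendsto_integral_of_L1' _ h3.1
      (Eventually.of_forall fun k => memLp_one_iff_integrable.1 (h2 k)) h4
    -- `h1` says that the constants `F k a = F k - ∫_a (F k)'` converge in `L_1`
    have hc : ∃ c, Tendsto (fun k => F k a) atTop (𝓝 c) := by
      refine ⟨_, (hint.const_mul ((b - a : ℝ) : ℂ)⁻¹).congr fun k => ?_⟩
      have e : ∫ t in Icc a b, (F k + (-1 : ℂ) • primitive a 0 (derivWithin (F k) (Icc a b))) t =
          ∫ _ in Icc a b, F k a := by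
        refine setIntegral_congr_fun measurableSet_Icc fun t ht => ?_
        simp only [Pi.add_apply, Pi.smul_apply]
        rw [(hF k).eq_primitive hab hp ht]
        simp [primitive]
      have hba : ((b - a : ℝ) : ℂ) ≠ 0 := by
        rw [Complex.ofReal_ne_zero]; linarith
      rw [e, setIntegral_const, measureReal_def, Real.volume_Icc,
        ENNReal.toReal_ofReal (by linarith), Complex.real_smul, inv_mul_cancel_left₀ hba]
    obtain ⟨c, hc⟩ := hc
    have hfin := (hder.primitive hab hp hc).congr_eqOn (G := F) hab
      (fun k t ht => ((hF k).eq_primitive hab hp ht).symm) (fun t _ => rfl)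
    refine ⟨_, hfin.2.1, fun i hi => ?_⟩
    cases i with
    | zero => simpa using (hfin.of_le hab (Nat.zero_le _)).unique_ae hp h0
    | succ i =>
      rw [iteratedDerivWithin_succ']
      refine EventuallyEq.trans ?_ (hhg i (by omega))
      exact iteratedDerivWithin_ae_congr hab (by omega) (hfin.2.1.derivWithin hab) hh
        (derivWithin_primitive_ae hab (intervalIntegrable_of_memLp hab hp
          (hh.of_le hab (Nat.zero_le s))) c)

end Closed

/-! ### The Sobolev norm and completeness -/

section SobolevSpace

variable {a b : ℝ} [hab : Fact (a < b)] {p : ℝ≥0∞} [hp : Fact (1 ≤ p)] {s : ℕ}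

theorem tendsto_piLp_iff {ι : Type*} [Fintype ι] {X : ι → Type*} [∀ i, SeminormedAddCommGroup (X i)]
    {u : ℕ → PiLp 1 X} {v : PiLp 1 X} :
    Tendsto u atTop (𝓝 v) ↔ ∀ i, Tendsto (fun k => u k i) atTop (𝓝 (v i)) := by
  constructor
  · intro h i
    exact tendsto_pi_nhds.1 (((PiLp.continuous_ofLp 1 X).tendsto v).comp h) i
  · intro h
    exact ((PiLp.continuous_toLp 1 X).tendsto (WithLp.ofLp v)).comp (tendsto_pi_nhds.2 h)

theorem sobolev_tendsto_iff {y : ℕ → Sobolev a b p s} {z : Sobolev a b p s} :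
    Tendsto y atTop (𝓝 z) ↔ TendstoW a b p s (fun k => rep (y k)) (rep z) := by
  rw [tendsto_subtype_rng, tendsto_piLp_iff]
  have key : ∀ i : Fin (s + 1), Tendsto (fun k => (y k).1 i) atTop (𝓝 (z.1 i)) ↔
      Tendsto (fun k => eLpNorm (iteratedDerivWithin i (rep (y k)) (Icc a b) -
        iteratedDerivWithin i (rep z) (Icc a b)) p (volume.restrict (Icc a b))) atTop (𝓝 0) := by
    intro i
    rw [Lp.tendsto_Lp_iff_tendsto_eLpNorm']
    refine tendsto_congr fun k => eLpNorm_congr_ae ?_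
    exact (rep_spec (y k) i).sub (rep_spec z i)
  constructor
  · exact fun h => ⟨fun k => rep_memW _, rep_memW _, fun i hi =>
      (key ⟨i, by omega⟩).1 (h ⟨i, by omega⟩)⟩
  · exact fun h i => (key i).2 (h.2.2 i (by omega))

theorem rep_ofFun_ae {f : ℝ → ℂ} (hf : MemW a b p s f) :
    rep (ofFun f hf) =ᵐ[volume.restrict (Icc a b)] f := by
  have h := rep_spec (ofFun f hf) 0
  have h2 := MemLp.coeFn_toLp (hf.memLp hab.out (Nat.zero_le s))
  simpa using h.symm.trans h2

/-- For `s + 1 ≥ 1` the representative of the class of `f` agrees with `f` at every point of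
`[a,b]`, as both are continuous. -/
theorem rep_ofFun_eqOn {f : ℝ → ℂ} (hf : MemW a b p (s + 1) f) :
    EqOn (rep (ofFun f hf)) f (Icc a b) :=
  Measure.eqOn_Icc_of_ae_eq volume hab.out.ne (rep_ofFun_ae hf) (rep_memW _).continuousOn
    hf.continuousOn

theorem sobolev_ext {y z : Sobolev a b p s} (h : rep y =ᵐ[volume.restrict (Icc a b)] rep z) :
    y = z := by
  apply Subtype.ext
  ext1 i
  apply Lp.ext
  exact (rep_spec y i).trans ((iteratedDerivWithin_ae_congr hab.out (by omega) (rep_memW y)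
    (rep_memW z) h).trans (rep_spec z i).symm)

theorem sobolev_tendsto_ofFun_iff {F : ℕ → ℝ → ℂ} {f : ℝ → ℂ} (hF : ∀ k, MemW a b p s (F k))
    (hf : MemW a b p s f) :
    Tendsto (fun k => ofFun (F k) (hF k)) atTop (𝓝 (ofFun f hf)) ↔ TendstoW a b p s F f := by
  rw [sobolev_tendsto_iff]
  exact ⟨fun h => h.congr hab.out hF hf (fun k => rep_ofFun_ae (hF k)) (rep_ofFun_ae hf),
    fun h => h.congr hab.out (fun k => rep_memW _) (rep_memW _)
      (fun k => (rep_ofFun_ae (hF k)).symm) (rep_ofFun_ae hf).symm⟩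

instance : CompleteSpace (Sobolev a b p s) := by
  refine IsComplete.completeSpace_coe (IsClosed.isComplete ?_)
  refine IsSeqClosed.isClosed fun d e hd hlim => ?_
  choose F hF hdF using hd
  rw [tendsto_piLp_iff] at hlim
  obtain ⟨f, hf, hfe⟩ := exists_memW_of_tendsto hab.out hp.out (s := s) (F := F)
    (g := fun i => if h : i < s + 1 then e ⟨i, h⟩ else 0) hF
    (fun i hi => by
      rw [dif_pos (by omega)]
      exact Lp.memLp _)
    (fun i hi => by
      have hi' : i < s + 1 := by omega
      simp only [dif_pos hi']
      have h := (Lp.tendsto_Lp_iff_tendsto_eLpNorm' _ _).1 (hlim ⟨i, hi'⟩)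
      refine h.congr fun k => eLpNorm_congr_ae ?_
      exact (hdF k ⟨i, hi'⟩).sub EventuallyEq.rfl)
  refine ⟨f, hf, fun i => ?_⟩
  have := hfe i (by omega)
  rw [dif_pos i.2] at this
  exact this.symm

end SobolevSpace

/-! ### Convergence of the characteristic matrices -/

section Characteristic

variable {a b : ℝ} [hab : Fact (a < b)] {p : ℝ≥0∞} [hp : Fact (1 ≤ p)] {n m r l : ℕ}

theorem diffOp_eq_zero_iff {A : Fin r → Matrix (Fin m) (Fin m) (Sobolev a b p n)}
    {y : SobolevVec a b p (n + r) m} :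
    diffOp A y = 0 ↔ ∀ i, diffExpr A y i =ᵐ[volume.restrict (Icc a b)] 0 := by
  have h0 : rep (0 : Sobolev a b p n) =ᵐ[volume.restrict (Icc a b)] 0 := by
    simpa using (rep_spec (0 : Sobolev a b p n) 0).symm.trans (Lp.coeFn_zero _ _ _)
  constructor
  · intro h i
    have hi : ofFun (diffExpr A y i) (diffExpr_memW A y i) = 0 := congrArg (fun v => v i) h
    refine (rep_ofFun_ae (diffExpr_memW A y i)).symm.trans ?_
    rw [hi]
    exact h0
  · intro h
    ext1 i
    exact sobolev_ext ((rep_ofFun_ae (diffExpr_memW A y i)).trans ((h i).trans h0.symm))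

/-- The matrix Cauchy problem splits into initial value problems for the columns. -/
theorem isCauchySolution_iff {A : Fin r → Matrix (Fin m) (Fin m) (Sobolev a b p n)} {i : Fin r}
    {Y : Fin m → SobolevVec a b p (n + r) m} : IsCauchySolution A i Y ↔
      ∀ c, IsIVPSolution a b p n (fun j q q' => rep (A j q q'))
        (fun j q => (if i = j then (1 : Matrix (Fin m) (Fin m) ℂ) else 0) q c)
        (fun q => rep (Y c q)) := by
  simp only [IsCauchySolution, diffOp_eq_zero_iff, IsIVPSolution]
  exact ⟨fun h c => ⟨fun q => rep_memW _, h.1 c, fun j q => h.2 j q c⟩,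
    fun h => ⟨fun c => (h c).2.1, fun j q c => (h c).2.2 j q⟩⟩

theorem existsUnique_isCauchySolution (hr : 0 < r)
    (A : Fin r → Matrix (Fin m) (Fin m) (Sobolev a b p n)) (i : Fin r) :
    ∃! Y, IsCauchySolution A i Y := by
  have hA : ∀ j q q', MemW a b p n (rep (A j q q')) := fun j q q' => rep_memW _
  obtain ⟨d, rfl⟩ : ∃ d, r = d + 1 := ⟨r - 1, by omega⟩
  choose y hy using fun c : Fin m => exists_isIVPSolution hab.out hp.out hr hA
    (fun j q => (if i = j then (1 : Matrix (Fin m) (Fin m) ℂ) else 0) q c)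
  refine ⟨fun c => WithLp.toLp 1 fun q => ofFun (y c q) ((hy c).1 q), ?_, fun Y hY => ?_⟩
  · refine isCauchySolution_iff.2 fun c => (hy c).congr hab.out fun q => ?_
    exact (rep_ofFun_eqOn (s := n + d) ((hy c).1 q)).symm
  · ext c q : 2
    refine sobolev_ext (ae_of_eqOn ?_)
    exact ((isCauchySolution_iff.1 hY c).eqOn hab.out hp.out hr hA (hy c) q).trans
      (rep_ofFun_eqOn (s := n + d) ((hy c).1 q)).symm

theorem isCauchySolution_cauchySolution (hr : 0 < r)
    (A : Fin r → Matrix (Fin m) (Fin m) (Sobolev a b p n)) (i : Fin r) :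
    IsCauchySolution A i (cauchySolution A i) :=
  Classical.epsilon_spec (existsUnique_isCauchySolution hr A i).exists

theorem tendsto_diffOp_iff {A : Fin r → Matrix (Fin m) (Fin m) (Sobolev a b p n)}
    {Ak : ℕ → Fin r → Matrix (Fin m) (Fin m) (Sobolev a b p n)}
    {y : SobolevVec a b p (n + r) m} :
    Tendsto (fun k => diffOp (Ak k) y) atTop (𝓝 (diffOp A y)) ↔
      ∀ i, TendstoW a b p n (fun k => diffExpr (Ak k) y i) (diffExpr A y i) := by
  rw [tendsto_piLp_iff]
  exact forall_congr' fun i => sobolev_tendsto_ofFun_iff (fun k => diffExpr_memW (Ak k) y i)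
    (diffExpr_memW A y i)

/-- The vector function whose only nonzero component is `(t - a)^d / d!`, in the place `q₀`. -/
noncomputable def testVec (a b : ℝ) [hab : Fact (a < b)] (p : ℝ≥0∞) [hp : Fact (1 ≤ p)] {m : ℕ}
    (s d : ℕ) (q₀ : Fin m) : SobolevVec a b p s m :=
  WithLp.toLp 1 (Pi.single q₀ (ofFun _ (memW_taylorMonomial hab.out hp.out d s)))

theorem diffExpr_testVec_ae (A : Fin r → Matrix (Fin m) (Fin m) (Sobolev a b p n)) {d : ℕ}
    (hd : d < r) (q₀ i : Fin m) : diffExpr A (testVec a b p (n + r) d q₀) i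
      =ᵐ[volume.restrict (Icc a b)] fun t => ∑ j : Fin r,
        rep (A j i q₀) t * iteratedDerivWithin j (taylorMonomial a d) (Icc a b) t := by
  have h0 : ∀ j ≤ n + r, iteratedDerivWithin j (rep (0 : Sobolev a b p (n + r))) (Icc a b)
      =ᵐ[volume.restrict (Icc a b)] 0 := fun j hj =>
    (rep_spec (0 : Sobolev a b p (n + r)) ⟨j, by omega⟩).symm.trans (Lp.coeFn_zero _ _ _)
  have h1 : ∀ j ≤ n + r, iteratedDerivWithin j (rep (testVec a b p (n + r) d q₀ q₀)) (Icc a b)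
      =ᵐ[volume.restrict (Icc a b)] iteratedDerivWithin j (taylorMonomial a d) (Icc a b) := by
    intro j hj
    have e : testVec a b p (n + r) d q₀ q₀ =
        ofFun _ (memW_taylorMonomial hab.out hp.out d (n + r)) := by simp [testVec]
    rw [e]
    exact iteratedDerivWithin_ae_congr hab.out hj (rep_memW _)
      (memW_taylorMonomial hab.out hp.out d (n + r)) (rep_ofFun_ae _)
  have h2 : ∀ q ≠ q₀, testVec a b p (n + r) d q₀ q = 0 := fun q hq => by simp [testVec, hq]
  have h0' := ae_all_iff.2 fun j : Fin (r + 1) => h0 j (by omega)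
  have h1' := ae_all_iff.2 fun j : Fin (r + 1) => h1 j (by omega)
  filter_upwards [h0', h1', ae_restrict_mem measurableSet_Icc] with t ht0 ht1 hmem
  have hr0 : iteratedDerivWithin r (rep (testVec a b p (n + r) d q₀ i)) (Icc a b) t = 0 := by
    by_cases hi : i = q₀
    · subst hi
      exact (ht1 (Fin.last r)).trans (iteratedDerivWithin_taylorMonomial_of_lt hab.out hd hmem)
    · rw [h2 i hi]
      exact ht0 (Fin.last r)
  rw [diffExpr, hr0, zero_add]
  refine Finset.sum_congr rfl fun j _ => ?_
  rw [Finset.sum_eq_single q₀]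
  · exact congrArg (fun z => rep (A j i q₀) t * z) (ht1 j.castSucc)
  · intro q _ hq
    rw [h2 q hq]
    have := ht0 j.castSucc
    rw [Fin.val_castSucc] at this
    rw [this, Pi.zero_apply, mul_zero]
  · simp

/-- A coefficient is recovered from the values of the operator on the test functions and from
the coefficients with smaller indices. -/
theorem rep_coeff_ae (A : Fin r → Matrix (Fin m) (Fin m) (Sobolev a b p n)) {d : ℕ} (hd : d < r)
    (q q' : Fin m) : diffExpr A (testVec a b p (n + r) d q') q +
      (-1 : ℂ) • (fun t => ∑ j ∈ Finset.univ.filter (fun j : Fin r => (j : ℕ) < d),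
        (rep (A j q q') * iteratedDerivWithin j (taylorMonomial a d) (Icc a b)) t)
      =ᵐ[volume.restrict (Icc a b)] rep (A ⟨d, hd⟩ q q') := by
  filter_upwards [diffExpr_testVec_ae A hd q' q, ae_restrict_mem measurableSet_Icc] with t ht hmem
  simp only [Pi.add_apply, Pi.smul_apply, Pi.mul_apply]
  rw [ht, ← Finset.sum_filter_add_sum_filter_not Finset.univ (fun j : Fin r => (j : ℕ) < d),
    Finset.sum_eq_single_of_mem (s := Finset.univ.filter fun j : Fin r => ¬ (j : ℕ) < d)
      ⟨d, hd⟩ (by simp)]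
  · rw [iteratedDerivWithin_taylorMonomial_self hab.out d hmem, Pi.one_apply, mul_one,
      smul_eq_mul]
    ring
  · intro j hj hne
    have hdj : d < j := by
      have h3 := (Finset.mem_filter.1 hj).2
      have h4 : (j : ℕ) ≠ d := fun h => hne (Fin.ext h)
      omega
    rw [iteratedDerivWithin_taylorMonomial_of_lt hab.out hdj hmem, Pi.zero_apply, mul_zero]

/-- Strong convergence of the differential operators implies convergence of their coefficients:
applied to `(t - a)^d / d!`, the operator gives the coefficient with the index `d` plus a
combination of the coefficients with smaller indices. -/
theorem tendstoW_coeff {A : Fin r → Matrix (Fin m) (Fin m) (Sobolev a b p n)}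
    {Ak : ℕ → Fin r → Matrix (Fin m) (Fin m) (Sobolev a b p n)}
    (h : ∀ y : SobolevVec a b p (n + r) m,
      Tendsto (fun k => diffOp (Ak k) y) atTop (𝓝 (diffOp A y))) (j : Fin r) (q q' : Fin m) :
    TendstoW a b p n (fun k => rep (Ak k j q q')) (rep (A j q q')) := by
  obtain ⟨d, hd⟩ := j
  induction d using Nat.strong_induction_on with
  | _ d ih =>
    have h1 := tendsto_diffOp_iff.1 (h (testVec a b p (n + r) d q')) q
    have h2 := TendstoW.sum hab.out hp.out (Finset.univ.filter fun j : Fin r => (j : ℕ) < d)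
      fun j hj => (ih j (Finset.mem_filter.1 hj).2 j.2).mul hab.out hp.out (tendstoW_const
        ((memW_taylorMonomial hab.out hp.out d (n + 1 + j)).iteratedDerivWithin hab.out j))
    exact (h1.add hab.out hp.out (h2.smul (-1))).congr hab.out (fun k => rep_memW _)
      (rep_memW _) (fun k => rep_coeff_ae (Ak k) hd q q') (rep_coeff_ae A hd q q')

theorem tendsto_cauchySolution (hr : 0 < r)
    {A : Fin r → Matrix (Fin m) (Fin m) (Sobolev a b p n)}
    {Ak : ℕ → Fin r → Matrix (Fin m) (Fin m) (Sobolev a b p n)}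
    (h : ∀ y : SobolevVec a b p (n + r) m,
      Tendsto (fun k => diffOp (Ak k) y) atTop (𝓝 (diffOp A y))) (i : Fin r) (c : Fin m) :
    Tendsto (fun k => cauchySolution (Ak k) i c) atTop (𝓝 (cauchySolution A i c)) := by
  rw [tendsto_piLp_iff]
  intro q
  rw [sobolev_tendsto_iff]
  exact IsIVPSolution.tendstoW hab.out hp.out hr (tendstoW_coeff h)
    (isCauchySolution_iff.1 (isCauchySolution_cauchySolution hr A i) c)
    (fun k => isCauchySolution_iff.1 (isCauchySolution_cauchySolution hr (Ak k) i) c) q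

/-- A strongly convergent sequence of operators on a Banach space is equicontinuous, so it may be
applied to a convergent sequence of vectors. -/
theorem tendsto_clm_apply_of_strong {X Z : Type*} [NormedAddCommGroup X] [NormedSpace ℂ X]
    [CompleteSpace X] [NormedAddCommGroup Z] [NormedSpace ℂ Z] {T : ℕ → X →L[ℂ] Z} {S : X →L[ℂ] Z}
    (hT : ∀ x, Tendsto (fun k => T k x) atTop (𝓝 (S x))) {u : ℕ → X} {v : X}
    (hu : Tendsto u atTop (𝓝 v)) : Tendsto (fun k => T k (u k)) atTop (𝓝 (S v)) := by
  obtain ⟨C, hC⟩ := banach_steinhaus fun x => by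
    obtain ⟨C, hC⟩ := (hT x).norm.bddAbove_range
    exact ⟨C, fun k => hC ⟨k, rfl⟩⟩
  have h1 : Tendsto (fun k => T k (u k - v)) atTop (𝓝 0) := by
    refine squeeze_zero_norm (fun k => (T k).le_of_opNorm_le (hC k) _) ?_
    simpa using (tendsto_iff_norm_sub_tendsto_zero.1 hu).const_mul C
  simpa using h1.add (hT v)

-- the normed structure of `SobolevVec` is found through several layers of submodules and products
set_option synthInstance.maxHeartbeats 200000 in
theorem tendsto_charMatrix (hr : 0 < r)
    {A : Fin r → Matrix (Fin m) (Fin m) (Sobolev a b p n)}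
    {B : SobolevVec a b p (n + r) m →L[ℂ] (Fin l → ℂ)}
    {Ak : ℕ → Fin r → Matrix (Fin m) (Fin m) (Sobolev a b p n)}
    {Bk : ℕ → SobolevVec a b p (n + r) m →L[ℂ] (Fin l → ℂ)}
    (h : ∀ y : SobolevVec a b p (n + r) m,
      Tendsto (fun k => bvpOp (Ak k) (Bk k) y) atTop (𝓝 (bvpOp A B y))) :
    Tendsto (fun k => charMatrix (Ak k) (Bk k)) atTop (𝓝 (charMatrix A B)) := by
  have hY := tendsto_cauchySolution hr fun y => (h y).fst_nhds
  have hB := fun i c => tendsto_clm_apply_of_strong (T := Bk) (S := B)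
    (fun y => (h y).snd_nhds) (hY i c)
  exact tendsto_pi_nhds.2 fun q => tendsto_pi_nhds.2 fun ic =>
    tendsto_pi_nhds.1 (hB ic.1 ic.2) q

end Characteristic

end BVP

theorem theorem3 (a b : ℝ) [Fact (a < b)] (p : ENNReal) [Fact (1 ≤ p)] (n m r l : ℕ)
    (hm : 1 ≤ m) (hr : 1 ≤ r) (hl : 1 ≤ l)
    (A : Fin r → Matrix (Fin m) (Fin m) (BVP.Sobolev a b p n))
    (B : BVP.SobolevVec a b p (n + r) m →L[ℂ] (Fin l → ℂ))
    (Ak : ℕ → Fin r → Matrix (Fin m) (Fin m) (BVP.Sobolev a b p n))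
    (Bk : ℕ → BVP.SobolevVec a b p (n + r) m →L[ℂ] (Fin l → ℂ))
    (hstrong : ∀ y : BVP.SobolevVec a b p (n + r) m,
      Filter.Tendsto (fun k => BVP.bvpOp (Ak k) (Bk k) y) Filter.atTop
        (nhds (BVP.bvpOp A B y))) :
    -- the matrix Cauchy problems that define the characteristic matrices are uniquely solvable
    (∀ i : Fin r, ∃! Y, BVP.IsCauchySolution A i Y) ∧
    (∀ (k : ℕ) (i : Fin r), ∃! Y, BVP.IsCauchySolution (Ak k) i Y) ∧
    -- convergence of the characteristic matrices
    Filter.Tendsto (fun k => BVP.charMatrix (Ak k) (Bk k)) Filter.atTop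
      (nhds (BVP.charMatrix A B)) := by
  exact ⟨BVP.existsUnique_isCauchySolution hr A,
    fun k => BVP.existsUnique_isCauchySolution hr (Ak k), BVP.tendsto_charMatrix hr hstrong⟩
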